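/- All rings are commutative with unit. For an ideal $J$ of a ring $R$ and an $R$-module $M$, let $\operatorname{depth}_J M$ be the supremum of the lengths of $M$-regular sequences with all terms in $J$. A ring $R$ is called almost Cohen–Macaulay if it is noetherian, nonzero, and $\operatorname{depth}_P R=\operatorname{depth}_{PR_P}R_P$ for every prime ideal $P$ of $R$. Let $B$ be a local almost Cohen–Macaulay ring, $I$ a proper ideal of $B$, and $A=B/I$. Let $\hat A$ be the completion of the local ring $A$ with respect to its maximal ideal. Then all formal fibers of $A$ are almost Cohen–Macaulay; that is, for every prime ideal $P$ of $A$, the ring $\kappa(P)\otimes_A\hat A$ is almost Cohen–Macaulay, where $\kappa(P)=A_P/PA_P$ is the residue field of $A$ at $P$. -/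

import Mathlib

/-- The depth of an ideal `I` on a module `M`: the supremum of the lengths of the `M`-regular
sequences `r₁, …, rₙ` all of whose terms lie in `I` (it is a maximum when `R` is noetherian,
`M` is finitely generated and `I M ≠ M`). -/
noncomputable def depthOn {R : Type*} [CommRing R] (I : Ideal R)
    (M : Type*) [AddCommGroup M] [Module R M] : ℕ∞ :=
  ⨆ (rs : List R) (_ : (∀ r ∈ rs, r ∈ I) ∧ RingTheory.Sequence.IsRegular M rs), (rs.length : ℕ∞)

/-- A commutative ring `A` is almost Cohen–Macaulay if it is noetherian, nonzero, and
`depth_P A = depth_{P A_P} A_P` for every prime ideal `P` of `A`. -/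
structure IsAlmostCohenMacaulay (A : Type*) [CommRing A] : Prop where
  isNoetherianRing : IsNoetherianRing A
  nontrivial : Nontrivial A
  depthOn_eq : ∀ (P : Ideal A) [P.IsPrime],
    depthOn P A =
      depthOn (IsLocalRing.maximalIdeal (Localization.AtPrime P)) (Localization.AtPrime P)

/-- The formal fiber of a local ring `A` at a prime ideal `P`: the ring `κ(P) ⊗[A] Â`, where `Â` is
the completion of `A` with respect to its maximal ideal. -/
abbrev FormalFiber (A : Type*) [CommRing A] [IsLocalRing A] (P : Ideal A) [P.IsPrime] : Type _ :=
  P.Fiber (AdicCompletion (IsLocalRing.maximalIdeal A) A)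

/-- A quotient of a local ring by a proper ideal is local. -/
theorem isLocalRing_quotient {B : Type*} [CommRing B] [IsLocalRing B] {I : Ideal B} (hI : I ≠ ⊤) :
    IsLocalRing (B ⧸ I) :=
  haveI : Nontrivial (B ⧸ I) := Ideal.Quotient.nontrivial_iff.mpr hI
  .of_surjective' (Ideal.Quotient.mk I) Ideal.Quotient.mk_surjective

/-! Write P for a prime of A = B/I and Q for its preimage in B. The whole argument runs on the
inequality dim ≤ depth + 1 for noetherian local rings (`HeightLeDepthAddOne`).

Since B is almost Cohen–Macaulay, every nonmaximal prime containing a maximal regular sequence `rs`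
of B is associated to B/(rs). Prime avoidance then gives one further element `a` such that (a, rs)
has radical m. The sequence stays regular in the flat extension B̂, and Krull's height theorem
bounds dim B̂ by the length of `rs` plus one (`heightLeDepthAddOne_of_flat`). The inequality passes
to every localization of B̂, because ht q + depth M ≤ ht m for q associated to M
(`IsAssociatedPrime.height_add_le`).

As Â = B̂/IB̂, a local ring of the formal fiber over P is the closed fiber F of a flat local map B_Q
→ B̂_q. For such a map A → S both depth and dimension are additive, so depth A ≤ dim A gives dim F −
depth F ≤ dim S − depth S ≤ 1 (`HeightLeDepthAddOne.of_surjective_of_ker_eq`). A nonzero noetherian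
ring whose local rings all satisfy the inequality is almost Cohen–Macaulay.

Depth is handled by hand: a weakly regular sequence in an ideal is maximal when its quotient has a
nonzero element killed by the ideal (`HasSocle`), and no other sequence in the ideal is longer
(`HasRegularSeq.le_length`). -/

section

/-! ### Regular sequences in an ideal, socles and depth -/

open RingTheory.Sequence Pointwise

/-- `I` contains a weakly `M`-regular sequence of length `n`. -/
def Ideal.HasRegularSeq {R : Type*} [CommRing R] (I : Ideal R) (M : Type*) [AddCommGroup M]
    [Module R M] (n : ℕ) : Prop :=
  ∃ rs : List R, rs.length = n ∧ (∀ r ∈ rs, r ∈ I) ∧ IsWeaklyRegular M rs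

/-- `M` has a nonzero element killed by `I`. -/
def Ideal.HasSocle {R : Type*} [CommRing R] (I : Ideal R) (M : Type*) [AddCommGroup M]
    [Module R M] : Prop :=
  ∃ z : M, z ≠ 0 ∧ ∀ r ∈ I, r • z = 0

section

variable {R : Type*} [CommRing R] {I : Ideal R} {M N : Type*} [AddCommGroup M] [Module R M]
  [AddCommGroup N] [Module R N]

theorem Ideal.HasSocle.of_injective (h : I.HasSocle M) (f : M →ₗ[R] N)
    (hf : Function.Injective f) : I.HasSocle N := by
  obtain ⟨z, hz, hI⟩ := h
  exact ⟨f z, by simpa using hf.ne hz, fun r hr ↦ by rw [← map_smul, hI r hr, map_zero]⟩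

theorem Ideal.HasSocle.not_isSMulRegular (h : I.HasSocle M) {r : R} (hr : r ∈ I) :
    ¬ IsSMulRegular M r := by
  obtain ⟨z, hz, hI⟩ := h
  exact fun hreg ↦ hz (hreg.right_eq_zero_of_smul (hI r hr))

theorem Ideal.hasSocle_quotient_iff (K : Submodule R M) :
    I.HasSocle (M ⧸ K) ↔ ∃ z ∉ K, ∀ r ∈ I, r • z ∈ K := by
  constructor
  · rintro ⟨z, hz, h⟩
    obtain ⟨z, rfl⟩ := K.mkQ_surjective z
    refine ⟨z, by simpa using hz, fun r hr ↦ ?_⟩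
    exact (Submodule.Quotient.mk_eq_zero K).mp (h r hr)
  · rintro ⟨z, hz, h⟩
    refine ⟨K.mkQ z, by simpa using hz, fun r hr ↦ ?_⟩
    exact (Submodule.Quotient.mk_eq_zero K).mpr (h r hr)

/-- A nonzero map R/I → M sends 1 to a socle element; if there is none, Hom(R/I, M) = 0, which
forces a regular element in the annihilator I of R/I. -/
theorem Ideal.exists_isSMulRegular_or_hasSocle [IsNoetherianRing R]
    (I : Ideal R) (M : Type*) [AddCommGroup M] [Module R M] [Module.Finite R M] :
    (∃ r ∈ I, IsSMulRegular M r) ∨ I.HasSocle M := by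
  by_contra! h
  obtain ⟨h, hs⟩ := h
  have : Subsingleton ((R ⧸ I) →ₗ[R] M) := by
    refine subsingleton_of_forall_eq 0 fun f ↦ ?_
    have hz : f 1 = 0 := by
      by_contra hz
      refine hs ⟨f 1, hz, fun r hr ↦ ?_⟩
      have : r • (1 : R ⧸ I) = 0 := by
        rw [Algebra.smul_def, mul_one]
        exact Ideal.Quotient.eq_zero_iff_mem.mpr hr
      rw [← map_smul, this, map_zero]
    ext
    simpa using hz
  obtain ⟨r, hr, hreg⟩ := IsSMulRegular.subsingleton_linearMap_iff.mp this
  rw [Ideal.annihilator_quotient] at hr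
  exact h r hr hreg

theorem IsSMulRegular.quotSMulTop_swap {x y : R} (hx : IsSMulRegular M x)
    (hxy : IsSMulRegular (QuotSMulTop x M) y) :
    IsSMulRegular (QuotSMulTop y M) x := by
  refine (isSMulRegular_quotient_iff_mem_of_smul_mem _ _).mpr fun a ha ↦ ?_
  obtain ⟨b, -, hb⟩ := ha
  have hb : y • b = x • a := hb
  obtain ⟨c, -, rfl⟩ : b ∈ x • (⊤ : Submodule R M) := by
    refine (isSMulRegular_quotient_iff_mem_of_smul_mem _ _).mp hxy b ?_
    rw [hb]
    exact Submodule.smul_mem_pointwise_smul _ _ _ trivial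
  have : a = y • c := hx (by
    change x • a = x • y • c
    rw [← hb, smul_comm x y]; rfl)
  rw [this]
  exact Submodule.smul_mem_pointwise_smul _ _ _ trivial

/-- If `x, y` are `M`-regular and `M/xM` has a nonzero element killed by `I ∋ y`,
so has `M/yM`. -/
theorem Ideal.HasSocle.quotSMulTop_exchange {x y : R} (hx : IsSMulRegular M x)
    (hy : IsSMulRegular M y) (hyI : y ∈ I) (h : I.HasSocle (QuotSMulTop x M)) :
    I.HasSocle (QuotSMulTop y M) := by
  rw [Ideal.hasSocle_quotient_iff] at h ⊢
  obtain ⟨z, hz, h⟩ := h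
  obtain ⟨w, -, hw⟩ := h y hyI
  have hw : x • w = y • z := hw
  refine ⟨w, ?_, fun r hr ↦ ?_⟩
  · rintro ⟨c, -, rfl⟩
    refine hz ?_
    have : z = x • c := hy (by
      change y • z = y • x • c
      rw [← hw, smul_comm y x]; rfl)
    rw [this]
    exact Submodule.smul_mem_pointwise_smul _ _ _ trivial
  · obtain ⟨c, -, hc⟩ := h r hr
    have hc : x • c = r • z := hc
    have : r • w = y • c := hx (by
      change x • r • w = x • y • c
      rw [smul_comm x r, hw, smul_comm r y, ← hc, smul_comm x y])
    rw [this]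
    exact Submodule.smul_mem_pointwise_smul _ _ _ trivial

theorem Ideal.hasRegularSeq_zero : I.HasRegularSeq M 0 := ⟨[], by simp⟩

theorem Ideal.hasRegularSeq_succ {n : ℕ} : I.HasRegularSeq M (n + 1) ↔
    ∃ x ∈ I, IsSMulRegular M x ∧ I.HasRegularSeq (QuotSMulTop x M) n := by
  constructor
  · rintro ⟨rs, hl, hI, hreg⟩
    match rs with
    | [] => simp at hl
    | x :: rs =>
      rw [isWeaklyRegular_cons_iff] at hreg
      exact ⟨x, hI x (by simp), hreg.1, rs, by simpa using hl,
        fun r hr ↦ hI r (by simp [hr]), hreg.2⟩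
  · rintro ⟨x, hx, hreg, rs, hl, hI, h⟩
    exact ⟨x :: rs, by simp [hl], by simpa [hx] using hI, .cons hreg h⟩

theorem Ideal.HasRegularSeq.congr {n : ℕ} (h : I.HasRegularSeq M n) (e : M ≃ₗ[R] N) :
    I.HasRegularSeq N n := by
  obtain ⟨rs, hl, hI, hreg⟩ := h
  exact ⟨rs, hl, hI, (e.isWeaklyRegular_congr rs).mp hreg⟩

theorem Ideal.HasRegularSeq.mono {J : Ideal R} {m n : ℕ} (h : I.HasRegularSeq M n) (hJ : I ≤ J)
    (hmn : m ≤ n) : J.HasRegularSeq M m := by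
  obtain ⟨rs, rfl, hI, hreg⟩ := h
  refine ⟨rs.take m, by simpa using hmn, fun r hr ↦ hJ (hI r (List.mem_of_mem_take hr)), ?_⟩
  rw [← List.take_append_drop m rs, isWeaklyRegular_append_iff] at hreg
  exact hreg.1

/-- `(M/xM)/yM ≃ (M/yM)/xM`. -/
noncomputable def QuotSMulTop.commEquiv (x y : R) (M : Type*) [AddCommGroup M] [Module R M] :
    QuotSMulTop y (QuotSMulTop x M) ≃ₗ[R] QuotSMulTop x (QuotSMulTop y M) :=
  Submodule.quotEquivOfEq _ _ (by
      rw [← Submodule.range_mkQ (x • (⊤ : Submodule R M)), ← Submodule.map_top,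
        ← Submodule.map_pointwise_smul]) ≪≫ₗ
    Submodule.quotientQuotientEquivQuotientSup (x • ⊤) (y • ⊤) ≪≫ₗ
    Submodule.quotEquivOfEq _ _ (sup_comm _ _) ≪≫ₗ
    (Submodule.quotientQuotientEquivQuotientSup (y • ⊤) (x • ⊤)).symm ≪≫ₗ
    Submodule.quotEquivOfEq _ _ (by
      rw [← Submodule.range_mkQ (y • (⊤ : Submodule R M)), ← Submodule.map_top,
        ← Submodule.map_pointwise_smul])

/-- Any regular element of I can serve as the first term of a longest sequence; this is what makes
depth well behaved. If a sequence starts with y, pass from y to x through an element z regular on M,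
M/xM and M/yM at once. -/
theorem Ideal.HasRegularSeq.quotSMulTop [IsNoetherianRing R] [Module.Finite R M] {n : ℕ}
    (h : I.HasRegularSeq M (n + 1)) {x : R} (hxI : x ∈ I) (hx : IsSMulRegular M x) :
    I.HasRegularSeq (QuotSMulTop x M) n := by
  induction n generalizing M x with
  | zero => exact Ideal.hasRegularSeq_zero
  | succ n ih =>
    obtain ⟨y, hyI, hy, hn⟩ := Ideal.hasRegularSeq_succ.mp h
    obtain ⟨w, hwI, hw, -⟩ := Ideal.hasRegularSeq_succ.mp hn
    -- Taking the direct sum yields one z regular on all three modules. A socle element of M/xM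
    -- would transfer to M/yM, where `w` is regular.
    have key : ¬ I.HasSocle (M × QuotSMulTop x M × QuotSMulTop y M) := by
      rintro ⟨⟨a, b, c⟩, hne, hk⟩
      refine hne ?_
      have ha : a = 0 := hx.right_eq_zero_of_smul (by simpa using congrArg Prod.fst (hk x hxI))
      have hc : c = 0 := hw.right_eq_zero_of_smul
        (by simpa using congrArg (Prod.snd ∘ Prod.snd) (hk w hwI))
      have hb : b = 0 := by
        by_contra hb
        refine Ideal.HasSocle.not_isSMulRegular
          (Ideal.HasSocle.quotSMulTop_exchange hx hy hyI ⟨b, hb, fun r hr ↦ ?_⟩) hwI hw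
        simpa using congrArg (Prod.fst ∘ Prod.snd) (hk r hr)
      rw [ha, hb, hc]; rfl
    obtain ⟨z, hzI, hz⟩ := (Ideal.exists_isSMulRegular_or_hasSocle I
      (M × QuotSMulTop x M × QuotSMulTop y M)).resolve_right key
    have hzM : IsSMulRegular M z := hz.of_injective (LinearMap.inl R _ _) LinearMap.inl_injective
    have hzx : IsSMulRegular (QuotSMulTop x M) z := hz.of_injective
      (LinearMap.inr R _ _ ∘ₗ LinearMap.inl R _ _)
      (LinearMap.inr_injective.comp LinearMap.inl_injective)
    have hzy : IsSMulRegular (QuotSMulTop y M) z := hz.of_injective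
      (LinearMap.inr R _ _ ∘ₗ LinearMap.inr R _ _)
      (LinearMap.inr_injective.comp LinearMap.inr_injective)
    refine Ideal.hasRegularSeq_succ.mpr ⟨z, hzI, hzx, ?_⟩
    refine Ideal.HasRegularSeq.congr ?_ (QuotSMulTop.commEquiv z x M)
    -- Induction is used twice: on M/yM with z, then on M/zM with x.
    refine ih ?_ hxI (hx.quotSMulTop_swap hzx)
    exact Ideal.hasRegularSeq_succ.mpr ⟨y, hyI, hy.quotSMulTop_swap hzy,
      (ih hn hzI hzy).congr (QuotSMulTop.commEquiv y z M)⟩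

theorem Ideal.HasRegularSeq.quotient_ofList [IsNoetherianRing R] [Module.Finite R M] {n : ℕ}
    {rs : List R} (h : I.HasRegularSeq M (rs.length + n)) (hI : ∀ r ∈ rs, r ∈ I)
    (hreg : IsWeaklyRegular M rs) :
    I.HasRegularSeq (M ⧸ (Ideal.ofList rs • ⊤ : Submodule R M)) n := by
  induction rs generalizing M with
  | nil =>
    rw [List.length_nil, zero_add] at h
    exact h.congr (Submodule.quotEquivOfEqBot _ (by simp)).symm
  | cons x rs ih =>
    rw [isWeaklyRegular_cons_iff] at hreg
    rw [List.length_cons, add_right_comm] at h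
    exact (ih (h.quotSMulTop (hI x (by simp)) hreg.1) (fun r hr ↦ hI r (by simp [hr])) hreg.2).congr
      (Submodule.quotOfListConsSMulTopEquivQuotSMulTopInner M x rs).symm

theorem Ideal.HasRegularSeq.le_length [IsNoetherianRing R] [Module.Finite R M] {n : ℕ}
    (h : I.HasRegularSeq M n) {rs : List R} (hI : ∀ r ∈ rs, r ∈ I) (hreg : IsWeaklyRegular M rs)
    (hs : I.HasSocle (M ⧸ (Ideal.ofList rs • ⊤ : Submodule R M))) : n ≤ rs.length := by
  by_contra! hlt
  obtain ⟨x, hx, hx', -⟩ := Ideal.hasRegularSeq_succ.mp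
    ((h.mono le_rfl (m := rs.length + 1) hlt).quotient_ofList hI hreg)
  exact hs.not_isSMulRegular hx hx'

theorem Ideal.HasRegularSeq.append {rs : List R} (hI : ∀ r ∈ rs, r ∈ I)
    (hreg : IsWeaklyRegular M rs) {n : ℕ}
    (h : I.HasRegularSeq (M ⧸ (Ideal.ofList rs • ⊤ : Submodule R M)) n) :
    I.HasRegularSeq M (rs.length + n) := by
  obtain ⟨ss, rfl, hI', hreg'⟩ := h
  refine ⟨rs ++ ss, by simp, fun r hr ↦ ?_, (isWeaklyRegular_append_iff M rs ss).mpr ⟨hreg, hreg'⟩⟩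
  rcases List.mem_append.mp hr with hr | hr
  exacts [hI r hr, hI' r hr]

/-- If lengths of weakly regular sequences in `I` are bounded, there is a maximal one, and
its quotient has a nonzero element killed by `I`. -/
theorem Ideal.exists_maximal_isWeaklyRegular [IsNoetherianRing R] [Module.Finite R M] {b : ℕ}
    (hb : ∀ n, I.HasRegularSeq M n → n ≤ b) :
    ∃ rs : List R, (∀ r ∈ rs, r ∈ I) ∧ IsWeaklyRegular M rs ∧
      I.HasSocle (M ⧸ (Ideal.ofList rs • ⊤ : Submodule R M)) := by
  classical
  have hP : I.HasRegularSeq M (Nat.findGreatest (I.HasRegularSeq M) b) :=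
    Nat.findGreatest_spec (Nat.zero_le b) Ideal.hasRegularSeq_zero
  obtain ⟨rs, hl, hI, hreg⟩ := hP
  refine ⟨rs, hI, hreg, ?_⟩
  refine (Ideal.exists_isSMulRegular_or_hasSocle I _).resolve_left ?_
  rintro ⟨r, hr, hr'⟩
  have h1 : I.HasRegularSeq M (rs.length + 1) := .append hI hreg
    (Ideal.hasRegularSeq_succ.mpr ⟨r, hr, hr', Ideal.hasRegularSeq_zero⟩)
  have := Nat.le_findGreatest (hb _ h1) h1
  lia

end

/-! ### Depth versus height in a local ring -/

section Local

open IsLocalRing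

variable {R : Type*} [CommRing R] [IsNoetherianRing R] [IsLocalRing R]

/-- If `p` is an associated prime of `M` and the maximal ideal contains an `M`-regular sequence of
length `n`, then `ht p + n ≤ ht m`. -/
theorem IsAssociatedPrime.height_add_le {M : Type*} [AddCommGroup M] [Module R M]
    [Module.Finite R M] {p : Ideal R} (hp : IsAssociatedPrime p M) {n : ℕ}
    (h : (maximalIdeal R).HasRegularSeq M n) : p.height + n ≤ (maximalIdeal R).height := by
  induction n generalizing M p with
  | zero => simpa using Ideal.height_mono (le_maximalIdeal hp.isPrime.ne_top)
  | succ n ih =>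
    obtain ⟨x, hxm, hx, hn⟩ := Ideal.hasRegularSeq_succ.mp h
    have := hp.isPrime
    obtain ⟨-, z₀, hz₀⟩ := isAssociatedPrime_iff.mp hp
    -- K is Hom(R/p, M), the elements killed by p. By Nakayama it is not contained in xM, since K ⊆
    -- xM would force K = xK.
    let K : Submodule R M :=
      { carrier := {z | ∀ r ∈ p, r • z = 0}
        add_mem' := fun ha hb r hr ↦ by rw [smul_add, ha r hr, hb r hr, add_zero]
        zero_mem' := fun r _ ↦ smul_zero r
        smul_mem' := fun c z hz r hr ↦ by rw [smul_comm, hz r hr, smul_zero] }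
    have hz₀K : z₀ ∈ K := fun r hr ↦ by
      rw [hz₀, Submodule.mem_colon_singleton] at hr
      simpa using hr
    have hz₀' : z₀ ≠ 0 := by
      rintro rfl
      apply hp.isPrime.ne_top
      rw [hz₀, Ideal.eq_top_iff_one]
      simp
    have hex : ∃ z ∈ K, z ∉ x • (⊤ : Submodule R M) := by
      by_contra! hK
      have hle : K ≤ maximalIdeal R • K := fun z hz ↦ by
        obtain ⟨c, -, hc⟩ := hK z hz
        have hc : x • c = z := hc
        rw [← hc]
        refine Submodule.smul_mem_smul hxm fun r hr ↦ hx.right_eq_zero_of_smul ?_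
        rw [smul_comm, hc, hz r hr]
      have := Submodule.eq_bot_of_le_smul_of_le_jacobson_bot _ K (IsNoetherian.noetherian K) hle
        (maximalIdeal_le_jacobson _)
      rw [this] at hz₀K
      exact hz₀' (by simpa using hz₀K)
    obtain ⟨z, hzK, hz⟩ := hex
    obtain ⟨q, hq, hle⟩ := exists_le_isAssociatedPrime_of_isNoetherianRing R
      (Submodule.Quotient.mk z : QuotSMulTop x M) (by simpa using hz)
    have hmem {r : R} (hr : r • z ∈ x • (⊤ : Submodule R M)) : r ∈ q :=
      hle (Submodule.mem_colon_singleton.mpr ((Submodule.Quotient.mk_eq_zero _).mpr hr))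
    -- q contains p and x, whereas x ∉ p because x is regular and p kills `z₀` ≠ 0. Each regular
    -- element thus costs one step of height.
    have hpq : p < q := by
      refine lt_of_le_of_ne (fun r hr ↦ hmem (by rw [hzK r hr]; exact zero_mem _)) ?_
      rintro rfl
      have hxp : x ∈ p := hmem (Submodule.smul_mem_pointwise_smul _ _ _ trivial)
      exact hz₀' (hx.right_eq_zero_of_smul (hz₀K x hxp))
    have := hq.isPrime
    have h2 := ih hq hn
    calc p.height + (n + 1 : ℕ) = p.height + 1 + n := by push_cast; ring
      _ ≤ q.height + n := by gcongr; exact Ideal.height_add_one_le_of_lt_of_isPrime hpq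
      _ ≤ _ := h2

theorem Ideal.HasRegularSeq.le_height {M : Type*} [AddCommGroup M] [Module R M]
    [Module.Finite R M] [Nontrivial M] {n : ℕ} (h : (maximalIdeal R).HasRegularSeq M n) :
    n ≤ (maximalIdeal R).height := by
  obtain ⟨p, hp⟩ := associatedPrimes.nonempty R M
  exact le_add_self.trans (IsAssociatedPrime.height_add_le hp h)

end Local

end

/-! ### Flat local homomorphisms and their closed fibers -/

section

open RingTheory.Sequence Pointwise TensorProduct

/-- `(M/K)/J(M/K) ≃ M/(K + JM)`. -/
noncomputable def Submodule.quotientSMulTopEquiv {S M : Type*} [CommRing S] [AddCommGroup M]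
    [Module S M] (K : Submodule S M) (J : Ideal S) :
    ((M ⧸ K) ⧸ (J • ⊤ : Submodule S (M ⧸ K))) ≃ₗ[S] M ⧸ (K ⊔ J • ⊤) :=
  Submodule.quotEquivOfEq _ _ (by
    rw [Submodule.map_smul'', Submodule.map_top, Submodule.range_mkQ]) ≪≫ₗ
  Submodule.quotientQuotientEquivQuotientSup K (J • ⊤)

section Colon

variable {A : Type*} [CommRing A] {M : Type*} [AddCommGroup M] [Module A M]

/-- Flatness preserves the kernel of multiplication by c from A to A/b, so (bM : c) = (b : c)M. -/
theorem Module.Flat.mem_smul_top_of_smul_mem [Module.Flat A M] {b d : Ideal A} {c : A}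
    (hd : ∀ a, c * a ∈ b → a ∈ d) {w : M} (h : c • w ∈ (b • ⊤ : Submodule A M)) :
    w ∈ (d • ⊤ : Submodule A M) := by
  let g : A →ₗ[A] A ⧸ b := b.mkQ ∘ₗ LinearMap.lsmul A A c
  have hg : LinearMap.ker g ≤ d := fun a ha ↦ hd a (by
    rw [← Ideal.Quotient.eq_zero_iff_mem]
    simpa [g] using ha)
  have hex : Function.Exact (LinearMap.ker g).subtype g :=
    LinearMap.exact_subtype_ker_map g
  have hex' := Module.Flat.rTensor_exact M hex
  have hz : ∀ v ∈ (b • ⊤ : Submodule A M), (1 : A ⧸ b) ⊗ₜ[A] v = 0 := by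
    intro v hv
    induction hv using Submodule.smul_induction_on' with
    | smul r hr m _ =>
      rw [← TensorProduct.smul_tmul, Algebra.smul_def, mul_one]
      have : algebraMap A (A ⧸ b) r = 0 := Ideal.Quotient.eq_zero_iff_mem.mpr hr
      rw [this, TensorProduct.zero_tmul]
    | add x _ y _ hx hy => rw [TensorProduct.tmul_add, hx, hy, add_zero]
  obtain ⟨t, ht⟩ := (hex' ((1 : A) ⊗ₜ w)).mp (by
    have : g 1 = c • (1 : A ⧸ b) := by
      simp only [g, LinearMap.comp_apply, LinearMap.lsmul_apply, map_smul]; rfl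
    rw [LinearMap.rTensor_tmul, this, TensorProduct.smul_tmul, hz _ h])
  have hmem : ∀ t : LinearMap.ker g ⊗[A] M, TensorProduct.lid A M
      ((LinearMap.ker g).subtype.rTensor M t) ∈ (d • ⊤ : Submodule A M) := by
    intro t
    induction t with
    | zero => simp
    | tmul x m => simpa using Submodule.smul_mem_smul (hg x.2) (Submodule.mem_top (x := m))
    | add x y hx hy => simpa using add_mem hx hy
  simpa [ht] using hmem t

end Colon

section

variable {A S : Type*} [CommRing A] [CommRing S] [Algebra A S]
  {M : Type*} [AddCommGroup M] [Module A M] [Module S M] [IsScalarTower A S M]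

theorem lid_rTensor_subtype_lTensor {N N' : Type*} [AddCommGroup N] [Module A N]
    [AddCommGroup N'] [Module A N'] (a : Ideal A) (f : N →ₗ[A] N') (s : a ⊗[A] N) :
    TensorProduct.lid A N' (a.subtype.rTensor N' (f.lTensor a s)) =
      f (TensorProduct.lid A N (a.subtype.rTensor N s)) := by
  induction s with
  | zero => simp
  | tmul x m => simp
  | add x y hx hy => simp only [map_add, hx, hy]

/-- If `y` is regular on `M/aM` for all ideals `a` of `A` and `M` is `A`-flat, then `M/yM` is
`A`-flat. -/
theorem Module.Flat.quotSMulTop [Module.Flat A M] {y : S}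
    (hy : ∀ (a : Ideal A) (z : M), y • z ∈ (a • ⊤ : Submodule A M) → z ∈ (a • ⊤ : Submodule A M)) :
    Module.Flat A (QuotSMulTop y M) := by
  have hqy (z : M) : (y • (⊤ : Submodule S M)).mkQ (y • z) = 0 :=
    (Submodule.Quotient.mk_eq_zero _).mpr (Submodule.smul_mem_pointwise_smul _ _ _ trivial)
  let q : M →ₗ[A] QuotSMulTop y M := (Submodule.mkQ (y • (⊤ : Submodule S M))).restrictScalars A
  let μ : M →ₗ[A] M := (LinearMap.lsmul S M y).restrictScalars A
  have hqμ : q ∘ₗ μ = 0 := by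
    refine LinearMap.ext fun z ↦ ?_
    rw [LinearMap.comp_apply, LinearMap.zero_apply]
    exact hqy z
  have hq : Function.Surjective q := (y • (⊤ : Submodule S M)).mkQ_surjective
  rw [Module.Flat.iff_rTensor_injective']
  intro a
  rw [injective_iff_map_eq_zero]
  intro t ht
  obtain ⟨t, rfl⟩ := LinearMap.lTensor_surjective a hq t
  let ι : a ⊗[A] M →ₗ[A] M := (TensorProduct.lid A M).toLinearMap ∘ₗ a.subtype.rTensor M
  have hιinj : Function.Injective ι := (TensorProduct.lid A M).injective.comp
    (Module.Flat.rTensor_preserves_injective_linearMap _ a.subtype_injective)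
  have hιmem : ∀ z ∈ (a • ⊤ : Submodule A M), ∃ s, ι s = z := by
    intro z hz
    induction hz using Submodule.smul_induction_on' with
    | smul r hr m _ => exact ⟨⟨r, hr⟩ ⊗ₜ m, by simp [ι]⟩
    | add x _ y _ hx hy =>
      obtain ⟨s, rfl⟩ := hx
      obtain ⟨s', rfl⟩ := hy
      exact ⟨s + s', map_add _ _ _⟩
  have hιmem' : ∀ s, ι s ∈ (a • ⊤ : Submodule A M) := by
    intro s
    induction s with
    | zero => simp
    | tmul x m => simpa [ι] using Submodule.smul_mem_smul x.2 (Submodule.mem_top (x := m))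
    | add x y hx hy => simpa using add_mem hx hy
  have h0 : q (ι t) = 0 := by
    simp only [ι, LinearMap.comp_apply, LinearEquiv.coe_coe]
    rw [← lid_rTensor_subtype_lTensor, ht, map_zero]
  obtain ⟨z, -, hz⟩ := (Submodule.Quotient.mk_eq_zero _).mp h0
  have hz : y • z = ι t := hz
  -- The image of t lies in yM ∩ aM, which is y(aM) by hypothesis; hence t is y times a tensor and
  -- dies in a ⊗ M/yM.
  obtain ⟨s, rfl⟩ := hιmem z (hy a z (hz ▸ hιmem' t))
  have : t = μ.lTensor a s := hιinj (hz.symm.trans (lid_rTensor_subtype_lTensor a μ s).symm)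
  rw [this, ← LinearMap.comp_apply, ← LinearMap.lTensor_comp, hqμ, LinearMap.lTensor_zero,
    LinearMap.zero_apply]

end

section Local

open IsLocalRing

theorem IsLocalRing.mem_maximalIdeal_of_mul_mem {A : Type*} [CommRing A] [IsLocalRing A]
    {b : Ideal A} {a c : A} (hc : c ∉ b) (h : c * a ∈ b) : a ∈ maximalIdeal A := by
  by_contra hna
  obtain ⟨v, hv⟩ := (notMem_maximalIdeal.mp hna).exists_left_inv
  refine hc ?_
  have := b.mul_mem_left v h
  rwa [mul_left_comm, hv, mul_one] at this

variable {A S : Type*} [CommRing A] [IsNoetherianRing A] [IsLocalRing A]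
  [CommRing S] [Algebra A S]

section

variable {M : Type*} [AddCommGroup M] [Module A M] [Module S M] [IsScalarTower A S M]

/-- Noetherian induction from above: a socle element c of A/b reduces b to the larger ideal b + (c).
The leftover term cw is controlled by the case of m, since (b : c) ⊆ m and cm ⊆ b. -/
theorem Module.Flat.mem_of_smul_mem_of_pow_le [Module.Flat A M] {y : S}
    (hy : ∀ z : M, y • z ∈ (maximalIdeal A • ⊤ : Submodule A M) →
      z ∈ (maximalIdeal A • ⊤ : Submodule A M)) {i : ℕ} (b : Ideal A) (hb : maximalIdeal A ^ i ≤ b)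
    (z : M) (hz : y • z ∈ (b • ⊤ : Submodule A M)) : z ∈ (b • ⊤ : Submodule A M) := by
  induction b using WellFoundedGT.induction generalizing z with
  | ind b ih =>
  by_cases hbt : b = ⊤
  · simp [hbt]
  obtain ⟨c, hcb, hc⟩ : ∃ c ∉ b, ∀ r ∈ maximalIdeal A, r * c ∈ b := by
    refine (Ideal.hasSocle_quotient_iff b).mp
      ((Ideal.exists_isSMulRegular_or_hasSocle _ _).resolve_left ?_)
    rintro ⟨r, hr, hreg⟩
    have h1 : (1 : A ⧸ b) = 0 := by
      refine (hreg.pow i).right_eq_zero_of_smul ?_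
      rw [Algebra.smul_def, mul_one]
      exact Ideal.Quotient.eq_zero_iff_mem.mpr (hb (Ideal.pow_mem_pow hr i))
    exact hbt ((Ideal.eq_top_iff_one b).mpr (Ideal.Quotient.eq_zero_iff_mem.mp h1))
  have hlt : b < b ⊔ Ideal.span {c} := by
    refine lt_of_le_of_ne le_sup_left fun h ↦ hcb ?_
    rw [h]
    exact Ideal.mem_sup_right (Ideal.mem_span_singleton_self c)
  have hz' := ih _ hlt (hb.trans hlt.le) z (Submodule.smul_mono_left hlt.le hz)
  rw [Submodule.sup_smul, Submodule.ideal_span_singleton_smul, Submodule.mem_sup] at hz'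
  obtain ⟨u, hu, _, ⟨w, -, rfl⟩, rfl⟩ := hz'
  change u + c • w ∈ _
  refine add_mem hu ?_
  have hyu : y • u ∈ (b • ⊤ : Submodule A M) := by
    rw [← Submodule.restrictScalars_top A S M, ← Ideal.smul_restrictScalars] at hu ⊢
    exact Submodule.smul_mem _ y hu
  have hcw : c • y • w ∈ (b • ⊤ : Submodule A M) := by
    rw [smul_comm]
    simpa [smul_add] using sub_mem hz hyu
  have hyw := Module.Flat.mem_smul_top_of_smul_mem (d := maximalIdeal A)
    (fun a ha ↦ IsLocalRing.mem_maximalIdeal_of_mul_mem hcb ha) hcw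
  have hw := hy w hyw
  have : ∀ v ∈ (maximalIdeal A • ⊤ : Submodule A M), c • v ∈ (b • ⊤ : Submodule A M) := by
    intro v hv
    induction hv using Submodule.smul_induction_on' with
    | smul r hr m _ =>
      rw [smul_smul, mul_comm]
      exact Submodule.smul_mem_smul (hc r hr) trivial
    | add x _ y _ hx hy => rw [smul_add]; exact add_mem hx hy
  exact this w hw

variable [IsNoetherianRing S] [IsLocalRing S] [IsLocalHom (algebraMap A S)]

/-- The case of a + mⁱ is known for every i, and Krull's intersection theorem in M/aM removes mⁱ. -/
theorem Module.Flat.mem_of_smul_mem [Module.Flat A M] [Module.Finite S M] {y : S}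
    (hy : ∀ z : M, y • z ∈ (maximalIdeal A • ⊤ : Submodule A M) →
      z ∈ (maximalIdeal A • ⊤ : Submodule A M)) (a : Ideal A)
    (z : M) (hz : y • z ∈ (a • ⊤ : Submodule A M)) : z ∈ (a • ⊤ : Submodule A M) := by
  let J := (maximalIdeal A).map (algebraMap A S)
  have hJ : J ≠ ⊤ := (((local_hom_TFAE (algebraMap A S)).out 0 2 rfl rfl).mp inferInstance).trans_lt
    (inferInstance : (maximalIdeal S).IsMaximal).lt_top |>.ne
  let K : Submodule S M := a.map (algebraMap A S) • ⊤
  have hK : K.restrictScalars A = a • ⊤ := Ideal.smul_restrictScalars a (⊤ : Submodule S M)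
  have hkr := Ideal.iInf_pow_smul_eq_bot_of_isLocalRing (M := M ⧸ K) J hJ
  rw [← hK]
  change z ∈ K
  rw [← Submodule.Quotient.mk_eq_zero, ← Submodule.mem_bot S, ← hkr, Submodule.mem_iInf]
  intro i
  have h1 := Module.Flat.mem_of_smul_mem_of_pow_le hy (i := i) (a ⊔ maximalIdeal A ^ i) le_sup_right
    z (Submodule.smul_mono_left le_sup_left hz)
  rw [Submodule.sup_smul, Submodule.mem_sup] at h1
  obtain ⟨u, hu, v, hv, rfl⟩ := h1
  rw [← hK] at hu
  have hu : u ∈ K := hu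
  have hv : v ∈ (J ^ i • ⊤ : Submodule S M) := by
    rw [← Submodule.restrictScalars_top A S M, ← Ideal.smul_restrictScalars, Ideal.map_pow] at hv
    exact hv
  rw [Submodule.Quotient.mk_add, (Submodule.Quotient.mk_eq_zero K).mpr hu, zero_add]
  have := Submodule.mem_map_of_mem (f := K.mkQ) hv
  rw [Submodule.map_smul''] at this
  exact (smul_mono_right (J ^ i) le_top :
    J ^ i • (⊤ : Submodule S M).map K.mkQ ≤ J ^ i • ⊤) this

/-- Let `A → S` be a local homomorphism of noetherian local rings and `M` a finite `S`-module which
is flat over `A`. A weakly regular sequence of `S` on `M/mM` is weakly regular on `M`, with quotient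
flat over `A`. -/
theorem RingTheory.Sequence.IsWeaklyRegular.of_quotient_maximalIdeal [Module.Flat A M]
    [Module.Finite S M] {ys : List S}
    (h : IsWeaklyRegular (M ⧸ ((maximalIdeal A).map (algebraMap A S) • ⊤ : Submodule S M)) ys) :
    IsWeaklyRegular M ys ∧ Module.Flat A (M ⧸ (Ideal.ofList ys • ⊤ : Submodule S M)) := by
  induction ys generalizing M with
  | nil =>
    refine ⟨.nil S M, Module.Flat.of_linearEquiv
      ((Submodule.quotEquivOfEqBot (Ideal.ofList ([] : List S) • ⊤ : Submodule S M)
        (by simp)).restrictScalars A)⟩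
  | cons y ys ih =>
    rw [isWeaklyRegular_cons_iff] at h
    obtain ⟨h1, h2⟩ := h
    rw [isSMulRegular_quotient_iff_mem_of_smul_mem] at h1
    have hy : ∀ z : M, y • z ∈ (maximalIdeal A • ⊤ : Submodule A M) →
        z ∈ (maximalIdeal A • ⊤ : Submodule A M) := by
      rw [← Submodule.restrictScalars_top A S M, ← Ideal.smul_restrictScalars]
      exact h1
    have hreg := Module.Flat.mem_of_smul_mem hy
    have hflat : Module.Flat A (QuotSMulTop y M) := Module.Flat.quotSMulTop hreg
    have hyM : IsSMulRegular M y := by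
      refine IsSMulRegular.of_right_eq_zero_of_smul fun z hz ↦ ?_
      -- The ideal a = 0 gives regularity on M itself.
      simpa using hreg ⊥ z (by simp [hz])
    let J := (maximalIdeal A).map (algebraMap A S)
    let e : QuotSMulTop y (M ⧸ (J • ⊤ : Submodule S M)) ≃ₗ[S]
        QuotSMulTop y M ⧸ (J • ⊤ : Submodule S (QuotSMulTop y M)) :=
      Submodule.quotEquivOfEq _ _ (by
          rw [← Submodule.range_mkQ (J • (⊤ : Submodule S M)), ← Submodule.map_top,
            ← Submodule.map_pointwise_smul]) ≪≫ₗ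
        Submodule.quotientQuotientEquivQuotientSup (J • ⊤) (y • ⊤) ≪≫ₗ
        Submodule.quotEquivOfEq _ _ (sup_comm _ _) ≪≫ₗ (Submodule.quotientSMulTopEquiv _ J).symm
    obtain ⟨h3, h4⟩ := ih ((e.isWeaklyRegular_congr ys).mp h2)
    refine ⟨.cons hyM h3, ?_⟩
    exact Module.Flat.of_linearEquiv ((Submodule.quotOfListConsSMulTopEquivQuotSMulTopInner M y
      ys).restrictScalars A)

end

/-- If c represents a socle element of A/X, multiplication by c embeds M/mM into M/XM by flatness,
and carries socle to socle. -/
theorem IsLocalRing.hasSocle_quotient_map_smul_top {A S M : Type*} [CommRing A] [IsLocalRing A]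
    [CommRing S] [Algebra A S] [IsLocalRing S] [AddCommGroup M] [Module A M] [Module S M]
    [IsScalarTower A S M] [Module.Flat A M] (X : Ideal A)
    (hX : (maximalIdeal A).HasSocle (A ⧸ X))
    (hM : (maximalIdeal S).HasSocle
      (M ⧸ ((maximalIdeal A).map (algebraMap A S) • ⊤ : Submodule S M))) :
    (maximalIdeal S).HasSocle (M ⧸ (X.map (algebraMap A S) • ⊤ : Submodule S M)) := by
  rw [Ideal.hasSocle_quotient_iff] at hM ⊢
  obtain ⟨c, hc, hcm⟩ := (Ideal.hasSocle_quotient_iff X).mp hX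
  obtain ⟨s, hs, hsm⟩ := hM
  have hmem (B : Ideal A) (v : M) : v ∈ (B.map (algebraMap A S) • ⊤ : Submodule S M) ↔
      v ∈ (B • ⊤ : Submodule A M) := by
    rw [← Submodule.restrictScalars_top A S M, ← Ideal.smul_restrictScalars,
      Submodule.restrictScalars_mem]
  simp only [hmem] at hs hsm ⊢
  refine ⟨c • s, fun h ↦ hs ?_, fun r hr ↦ ?_⟩
  · exact Module.Flat.mem_smul_top_of_smul_mem
      (fun a ha ↦ IsLocalRing.mem_maximalIdeal_of_mul_mem hc ha) h
  · have : ∀ v ∈ (maximalIdeal A • ⊤ : Submodule A M), c • v ∈ (X • ⊤ : Submodule A M) := by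
      intro v hv
      induction hv using Submodule.smul_induction_on' with
      | smul r hr m _ =>
        rw [smul_smul, mul_comm]
        exact Submodule.smul_mem_smul (hcm r hr) trivial
      | add x _ y _ hx hy => rw [smul_add]; exact add_mem hx hy
    rw [smul_comm]
    exact this _ (hsm r hr)

/-- A local ring whose maximal ideal has height at most one more than the length of some
weakly regular sequence in it. -/
def IsLocalRing.HeightLeDepthAddOne (R : Type*) [CommRing R] [IsLocalRing R] : Prop :=
  ∃ n : ℕ, (maximalIdeal R).HasRegularSeq R n ∧ (maximalIdeal R).height ≤ n + 1

theorem IsLocalRing.exists_maximal_isWeaklyRegular (R : Type*) [CommRing R] [IsNoetherianRing R]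
    [IsLocalRing R] : ∃ rs : List R, (∀ r ∈ rs, r ∈ maximalIdeal R) ∧ IsWeaklyRegular R rs ∧
      (maximalIdeal R).HasSocle (R ⧸ (Ideal.ofList rs • ⊤ : Submodule R R)) := by
  obtain ⟨b, hb⟩ := ENat.ne_top_iff_exists.mp
    (Ideal.height_ne_top (Ideal.IsPrime.ne_top' (I := maximalIdeal R)))
  refine Ideal.exists_maximal_isWeaklyRegular (b := b) fun n hn ↦ ?_
  have := hn.le_height
  rw [← hb] at this
  exact_mod_cast this

variable [IsNoetherianRing S] [IsLocalRing S] [IsLocalHom (algebraMap A S)]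

/-- Descent to the closed fibre of a flat local homomorphism. -/
theorem IsLocalRing.HeightLeDepthAddOne.of_surjective_of_ker_eq [Module.Flat A S]
    (h : HeightLeDepthAddOne S) {F : Type*} [CommRing F] [IsLocalRing F] (ψ : S →+* F)
    (hψ : Function.Surjective ψ) (hker : RingHom.ker ψ = (maximalIdeal A).map (algebraMap A S)) :
    HeightLeDepthAddOne F := by
  have : IsNoetherianRing F := isNoetherianRing_of_surjective S F ψ hψ
  obtain ⟨n, hn, hle⟩ := h
  obtain ⟨xs, hxs, hxreg, hxsoc⟩ := IsLocalRing.exists_maximal_isWeaklyRegular A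
  obtain ⟨fs, hfs, hfreg, hfsoc⟩ := IsLocalRing.exists_maximal_isWeaklyRegular F
  obtain ⟨ys, rfl⟩ : ∃ ys : List S, ys.map ψ = fs := by
    have := List.map_surjective_iff.mpr hψ
    exact this fs
  have hlocψ : (maximalIdeal F).comap ψ = maximalIdeal S :=
    IsLocalRing.eq_maximalIdeal (Ideal.comap_isMaximal_of_surjective ψ hψ)
  have hys : ∀ y ∈ ys, y ∈ maximalIdeal S := fun y hy ↦ by
    rw [← hlocψ]
    exact hfs _ (List.mem_map_of_mem hy)
  let J := (maximalIdeal A).map (algebraMap A S)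
  let : Algebra S F := ψ.toAlgebra
  have hJ : (J • ⊤ : Submodule S S) = LinearMap.ker (Algebra.linearMap S F) := by
    rw [smul_eq_mul, Ideal.mul_top]
    exact hker.symm
  let e : (S ⧸ (J • ⊤ : Submodule S S)) ≃ₗ[S] F :=
    Submodule.quotEquivOfEq _ _ hJ ≪≫ₗ
      LinearMap.quotKerEquivOfSurjective (Algebra.linearMap S F) hψ
  obtain ⟨hyreg, hflat⟩ := ((e.isWeaklyRegular_congr ys).mpr
    ((isWeaklyRegular_map_algebraMap_iff _ F ys).mp hfreg)).of_quotient_maximalIdeal (A := A)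
  let K : Submodule S S := Ideal.ofList ys • ⊤
  have hK : K = Ideal.ofList ys := by simp [K]
  have hxreg' : IsWeaklyRegular (S ⧸ K) (xs.map (algebraMap A S)) :=
    (isWeaklyRegular_map_algebraMap_iff _ (S ⧸ K) xs).mpr <|
      ((TensorProduct.lid A (S ⧸ K)).isWeaklyRegular_congr xs).mp hxreg.isWeaklyRegular_rTensor
  have hxs' : ∀ x ∈ xs.map (algebraMap A S), x ∈ maximalIdeal S := by
    intro x hx
    obtain ⟨a, ha, rfl⟩ := List.mem_map.mp hx
    rw [← Ideal.mem_comap, IsLocalRing.maximalIdeal_comap]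
    exact hxs a ha
  -- Lifts of a maximal sequence of F followed by a maximal sequence of A form a maximal sequence of
  -- S, so depth S = depth A + depth F.
  have hsoc : (maximalIdeal S).HasSocle
      (S ⧸ (Ideal.ofList (ys ++ xs.map (algebraMap A S)) • ⊤ : Submodule S S)) := by
    have hX : (maximalIdeal A).HasSocle (A ⧸ Ideal.ofList xs) := by
      rwa [smul_eq_mul, Ideal.mul_top] at hxsoc
    have hF : (maximalIdeal S).HasSocle ((S ⧸ K) ⧸ (J • ⊤ : Submodule S (S ⧸ K))) := by
      refine Ideal.HasSocle.of_injective ?_ (K.quotientSMulTopEquiv J).symm.toLinearMap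
        (K.quotientSMulTopEquiv J).symm.injective
      rw [Ideal.hasSocle_quotient_iff] at hfsoc ⊢
      have hcomap : (Ideal.ofList (ys.map ψ) • ⊤ : Ideal F).comap ψ = K ⊔ J • ⊤ := by
        rw [smul_eq_mul, smul_eq_mul, Ideal.mul_top, Ideal.mul_top, ← Ideal.map_ofList,
          Ideal.comap_map_of_surjective' ψ hψ, hker, hK]
      obtain ⟨f, hf, hfm⟩ := hfsoc
      obtain ⟨s, rfl⟩ := hψ f
      rw [← hcomap]
      refine ⟨s, hf, fun r hr ↦ ?_⟩
      rw [Ideal.mem_comap, smul_eq_mul r, map_mul]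
      exact hfm _ (by rwa [← hlocψ, Ideal.mem_comap] at hr)
    have hS := IsLocalRing.hasSocle_quotient_map_smul_top (M := S ⧸ K) _ hX hF
    let e' : ((S ⧸ K) ⧸ (Ideal.map (algebraMap A S) (Ideal.ofList xs) • ⊤ :
        Submodule S (S ⧸ K))) ≃ₗ[S]
        S ⧸ (Ideal.ofList (ys ++ xs.map (algebraMap A S)) • ⊤ : Submodule S S) :=
      (K.quotientSMulTopEquiv _).trans (Submodule.quotEquivOfEq _ _ (by
        rw [Ideal.ofList_append, Submodule.sup_smul, Ideal.map_ofList]))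
    exact hS.of_injective e'.toLinearMap e'.injective
  have hrs : ∀ r ∈ ys ++ xs.map (algebraMap A S), r ∈ maximalIdeal S := fun r hr ↦
    (List.mem_append.mp hr).elim (hys r) (hxs' r)
  have hn' := hn.le_length hrs ((isWeaklyRegular_append_iff S _ _).mpr ⟨hyreg, hxreg'⟩) hsoc
  have hxlen : (maximalIdeal A).HasRegularSeq A xs.length := ⟨xs, rfl, hxs, hxreg⟩
  have hA := hxlen.le_height
  have : (maximalIdeal S).LiesOver (maximalIdeal A) :=
    ⟨(IsLocalRing.maximalIdeal_comap (algebraMap A S)).symm⟩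
  -- Flatness gives going-down, hence dim S = dim A + dim F.
  have hht := Ideal.height_eq_height_add_of_liesOver_of_hasGoingDown (maximalIdeal A)
    (maximalIdeal S)
  let eF : S ⧸ J ≃+* F := (Ideal.quotEquivOfEq hker.symm).trans
    (RingHom.quotientKerEquivOfSurjective hψ)
  have hF : (maximalIdeal S).map (Ideal.Quotient.mk J) = (maximalIdeal F).comap eF := by
    have h1 : ((maximalIdeal F).comap eF).comap (Ideal.Quotient.mk J) = maximalIdeal S := by
      rw [← hlocψ]; rfl
    rw [← h1, Ideal.map_comap_of_surjective _ Ideal.Quotient.mk_surjective]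
  rw [hF, eF.height_comap] at hht
  refine ⟨ys.length, ⟨ys.map ψ, by simp, hfs, hfreg⟩, ?_⟩
  have hfinA := Ideal.height_ne_top (Ideal.IsPrime.ne_top' (I := maximalIdeal A))
  have hfinF := Ideal.height_ne_top (Ideal.IsPrime.ne_top' (I := maximalIdeal F))
  rw [hht] at hle
  obtain ⟨α, hα⟩ := ENat.ne_top_iff_exists.mp hfinA
  obtain ⟨φ, hφ⟩ := ENat.ne_top_iff_exists.mp hfinF
  rw [← hα] at hA hle
  rw [← hφ] at hle ⊢
  simp only [List.length_append, List.length_map] at hn'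
  norm_cast at *
  lia

end Local

end

/-! ### Completions: noetherianity and quotients -/

section

open RingTheory.Sequence TensorProduct

section Noetherian

/-- If `S` is complete for an ideal containing `a` and `S/aS` is noetherian, so is `S`. -/
theorem IsNoetherianRing.of_quotient_span_singleton {S : Type*} [CommRing S] (J : Ideal S)
    [IsAdicComplete J S] {a : S} (ha : a ∈ J) [IsNoetherianRing (S ⧸ Ideal.span {a})] :
    IsNoetherianRing S := by
  -- By Cohen's theorem it is enough that primes are finitely generated: lift generators of the
  -- image of P modulo a.
  refine IsNoetherianRing.of_prime fun P hP ↦ ?_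
  obtain ⟨n, g', hg'⟩ := Submodule.fg_iff_exists_fin_generating_family.mp
    (IsNoetherian.noetherian (P.map (Ideal.Quotient.mk (Ideal.span {a}))))
  have hlift : ∀ i, ∃ x ∈ P, Ideal.Quotient.mk (Ideal.span {a}) x = g' i := fun i ↦ by
    rw [← Ideal.mem_map_iff_of_surjective _ Ideal.Quotient.mk_surjective, ← hg']
    exact Submodule.subset_span ⟨i, rfl⟩
  choose g hgP hg using hlift
  have step : ∀ p ∈ P, ∃ (c : Fin n → S) (q : S), p = ∑ i, c i * g i + a * q := by
    intro p hp
    have h1 := Ideal.mem_map_of_mem (Ideal.Quotient.mk (Ideal.span {a})) hp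
    rw [← hg', Submodule.mem_span_range_iff_exists_fun] at h1
    obtain ⟨c', hc'⟩ := h1
    choose c hc using fun i ↦ Ideal.Quotient.mk_surjective (c' i)
    have h2 : p - ∑ i, c i * g i ∈ Ideal.span {a} := by
      rw [← Ideal.Quotient.eq, ← hc', map_sum]
      exact Finset.sum_congr rfl fun i _ ↦ by rw [map_mul, hc, hg, smul_eq_mul]
    obtain ⟨q, hq⟩ := Ideal.mem_span_singleton'.mp h2
    exact ⟨c, q, by rw [mul_comm a, hq]; ring⟩
  have hsum : ∀ c : Fin n → S, ∑ i, c i * g i ∈ Ideal.span (Set.range g) := fun c ↦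
    sum_mem fun i _ ↦ Ideal.mul_mem_left _ _ (Ideal.subset_span ⟨i, rfl⟩)
  have hgle : Ideal.span (Set.range g) ≤ P := Ideal.span_le.mpr (by rintro _ ⟨i, rfl⟩; exact hgP i)
  have hfg : (Ideal.span (Set.range g)).FG := Submodule.fg_span (Set.finite_range g)
  by_cases haP : a ∈ P
  · have : P = Ideal.span (Set.range g) ⊔ Ideal.span {a} := by
      refine le_antisymm (fun p hp ↦ ?_)
        (sup_le hgle ((Ideal.span_singleton_le_iff_mem P).mpr haP))
      obtain ⟨c, q, rfl⟩ := step p hp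
      exact add_mem (Ideal.mem_sup_left (hsum c)) (Ideal.mem_sup_right
        (Ideal.mul_mem_right _ _ (Ideal.mem_span_singleton_self a)))
    rw [this]
    exact Submodule.FG.sup hfg (Submodule.fg_span_singleton a)
  suffices P ≤ Ideal.span (Set.range g) by rwa [le_antisymm this hgle]
  -- When a ∉ P the remainder is a times an element of P, so the division can be iterated; the
  -- coefficients become convergent power series in a.
  have step' : ∀ p : P, ∃ (c : Fin n → S) (q : P), (p : S) = ∑ i, c i * g i + a * q := by
    rintro ⟨p, hp⟩
    obtain ⟨c, q, hq⟩ := step p hp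
    have h3 : a * q ∈ P := by
      have := sub_mem hp (hgle (hsum c))
      rwa [hq, add_sub_cancel_left] at this
    exact ⟨c, ⟨q, (hP.mem_or_mem h3).resolve_left haP⟩, hq⟩
  choose c next hnext using step'
  intro p hp
  let q : ℕ → P := fun k ↦ next^[k] ⟨p, hp⟩
  have hq (k : ℕ) : (q k : S) = ∑ i, c (q k) i * g i + a * q (k + 1) := by
    rw [hnext (q k)]
    simp only [q, Function.iterate_succ_apply']
  let s : ℕ → Fin n → S := fun N i ↦ ∑ k ∈ Finset.range N, a ^ k * c (q k) i
  have hs (N : ℕ) : p = ∑ i, s N i * g i + a ^ N * q N := by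
    induction N with
    | zero => simp [s, q]
    | succ N ih =>
      conv_lhs => rw [ih, hq N]
      simp only [s, Finset.sum_range_succ, add_mul, Finset.sum_add_distrib, mul_add,
        Finset.mul_sum, pow_succ]
      simp only [mul_assoc, add_assoc]
  have hpow (N : ℕ) (x : S) : a ^ N * x ∈ J ^ N := Ideal.mul_mem_right _ _ (Ideal.pow_mem_pow ha N)
  have hcauchy (i : Fin n) : ∃ L, ∀ N, s N i - L ∈ J ^ N := by
    obtain ⟨L, hL⟩ := IsPrecomplete.prec (I := J) (M := S) inferInstance (f := fun N ↦ s N i)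
      (fun {m N} hmN ↦ by
        rw [SModEq.sub_mem, smul_eq_mul, Ideal.mul_top, ← neg_sub, neg_mem_iff,
          Finset.sum_range_sub_sum_range hmN]
        refine sum_mem fun k hk ↦ Ideal.pow_le_pow_right ?_ (hpow k _)
        simp only [Finset.mem_filter, Finset.mem_range] at hk
        exact hk.2)
    refine ⟨L, fun N ↦ ?_⟩
    have := hL N
    rwa [SModEq.sub_mem, smul_eq_mul, Ideal.mul_top] at this
  choose L hL using hcauchy
  have hpL : p - ∑ i, L i * g i = 0 := by
    refine IsHausdorff.haus (I := J) inferInstance _ fun N ↦ ?_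
    rw [SModEq.zero, smul_eq_mul, Ideal.mul_top]
    have : p - ∑ i, L i * g i = ∑ i, (s N i - L i) * g i + a ^ N * q N := by
      conv_lhs => rw [hs N]
      simp only [sub_mul, Finset.sum_sub_distrib]
      ring
    rw [this]
    exact add_mem (sum_mem fun i _ ↦ Ideal.mul_mem_right _ _ (hL i N)) (hpow _ _)
  rw [sub_eq_zero.mp hpL]
  exact hsum L

end Noetherian

namespace AdicCompletion

variable {B A : Type*} [CommRing B] [CommRing A] [Algebra B A] (𝔞 : Ideal B)

/-- The map `AdicCompletion 𝔞 B → A / 𝔞ⁿA` for a `B`-algebra `A`. -/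
noncomputable def evalAlgebra (A : Type*) [CommRing A] [Algebra B A] (n : ℕ) :
    AdicCompletion 𝔞 B →+* A ⧸ (𝔞.map (algebraMap B A)) ^ n :=
  (Ideal.quotientMap ((𝔞.map (algebraMap B A)) ^ n) (algebraMap B A)
    (Ideal.map_le_iff_le_comap.mp (Ideal.map_pow _ _ _).le)).comp
      (evalₐ 𝔞 n : AdicCompletion 𝔞 B →+* B ⧸ 𝔞 ^ n)

theorem evalAlgebra_mk (n : ℕ) (x : AdicCauchySequence 𝔞 B) :
    evalAlgebra 𝔞 A n (mk 𝔞 B x) = Ideal.Quotient.mk _ (algebraMap B A (x n)) := by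
  rw [evalAlgebra, RingHom.comp_apply, RingHom.coe_coe, evalₐ_mk, Ideal.quotientMap_mk]

theorem factorPow_comp_evalAlgebra {m n : ℕ} (hmn : m ≤ n) :
    (Ideal.Quotient.factorPow (𝔞.map (algebraMap B A)) hmn).comp (evalAlgebra 𝔞 A n) =
      evalAlgebra 𝔞 A m := by
  ext x
  induction x using AdicCompletion.induction_on with
  | _ x =>
  rw [RingHom.comp_apply, evalAlgebra_mk, evalAlgebra_mk]
  change Ideal.Quotient.mk _ _ = _
  rw [← sub_eq_zero, ← map_sub, ← map_sub, Ideal.Quotient.eq_zero_iff_mem, ← Ideal.map_pow]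
  refine Ideal.mem_map_of_mem _ ?_
  have := x.2 hmn
  rw [SModEq.sub_mem, smul_eq_mul, Ideal.mul_top] at this
  rw [← neg_mem_iff, neg_sub]
  exact this

/-- The map `AdicCompletion 𝔞 B → AdicCompletion (𝔞 A) A` for a `B`-algebra `A`. -/
noncomputable def mapAlgebra (A : Type*) [CommRing A] [Algebra B A] :
    AdicCompletion 𝔞 B →+* AdicCompletion (𝔞.map (algebraMap B A)) A :=
  liftRingHom _ (evalAlgebra 𝔞 A) (factorPow_comp_evalAlgebra 𝔞)

theorem evalₐ_mapAlgebra_mk (n : ℕ) (x : AdicCauchySequence 𝔞 B) :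
    evalₐ _ n (mapAlgebra 𝔞 A (mk 𝔞 B x)) = Ideal.Quotient.mk _ (algebraMap B A (x n)) := by
  rw [mapAlgebra, evalₐ_liftRingHom, evalAlgebra_mk]

theorem mapAlgebra_algebraMap (b : B) :
    mapAlgebra 𝔞 A (algebraMap B _ b) = algebraMap A _ (algebraMap B A b) := by
  refine ext_evalₐ fun n ↦ ?_
  rw [mapAlgebra, evalₐ_liftRingHom, AlgHom.commutes]
  rfl

universe u

variable {B A : Type u} [CommRing B] [CommRing A] [Algebra B A] {𝔞 : Ideal B}

/-- Surjectivity modulo 𝔞 lifts, as the source is complete and the target separated. -/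
theorem mapAlgebra_surjective (h𝔞 : 𝔞.FG) (hA : Function.Surjective (algebraMap B A)) :
    Function.Surjective (mapAlgebra 𝔞 A) := by
  have := isAdicComplete_self _ h𝔞
  have h𝔟 : (𝔞.map (algebraMap B A)).FG := h𝔞.map _
  have := isAdicComplete_self _ h𝔟
  have hmap : (𝔞.map (algebraMap B (AdicCompletion 𝔞 B))).map (mapAlgebra 𝔞 A) =
      (𝔞.map (algebraMap B A)).map (algebraMap A _) := by
    rw [Ideal.map_map, Ideal.map_map]
    exact congrArg (fun g ↦ Ideal.map g 𝔞) (RingHom.ext (mapAlgebra_algebraMap (A := A) 𝔞))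
  have : IsHausdorff ((𝔞.map (algebraMap B (AdicCompletion 𝔞 B))).map (mapAlgebra 𝔞 A))
      (AdicCompletion (𝔞.map (algebraMap B A)) A) := by
    rw [hmap]; infer_instance
  refine surjective_of_mk_map_comp_surjective
    (I := 𝔞.map (algebraMap B (AdicCompletion 𝔞 B))) _ fun y ↦ ?_
  obtain ⟨y, rfl⟩ := Ideal.Quotient.mk_surjective y
  obtain ⟨a, ha⟩ := Ideal.Quotient.mk_surjective (evalOneₐ _ y)
  obtain ⟨b, rfl⟩ := hA a
  refine ⟨algebraMap B _ b, ?_⟩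
  rw [RingHom.comp_apply, mapAlgebra_algebraMap, Ideal.Quotient.eq, hmap,
    ← ker_evalOneₐ_eq_map _ h𝔟, RingHom.mem_ker]
  simp [ha, AlgHom.commutes]

/-- Completion is exact on 0 → ker → B → A → 0, and the completion of the finite module ker is
generated by ker. -/
theorem ker_mapAlgebra [IsNoetherianRing B] (hA : Function.Surjective (algebraMap B A)) :
    RingHom.ker (mapAlgebra 𝔞 A) = (RingHom.ker (algebraMap B A)).map (algebraMap B _) := by
  refine le_antisymm (fun x hx ↦ ?_) ?_
  · have hA' : Function.Surjective (Algebra.linearMap B A) := hA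
    have hzero : AdicCompletion.map 𝔞 (Algebra.linearMap B A) x = 0 := by
      induction x using AdicCompletion.induction_on with
      | _ x =>
      ext n
      rw [map_mk]
      have h1 := congrArg (evalₐ _ n) ((RingHom.mem_ker).mp hx)
      rw [evalₐ_mapAlgebra_mk, _root_.map_zero, Ideal.Quotient.eq_zero_iff_mem,
        ← Ideal.map_pow] at h1
      refine (Submodule.Quotient.mk_eq_zero _).mpr ?_
      rw [Ideal.smul_top_eq_map]
      exact h1
    have hexact := map_exact (I := 𝔞) (Submodule.subtype_injective _)
      (LinearMap.exact_subtype_ker_map (Algebra.linearMap B A)) hA'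
    obtain ⟨y, rfl⟩ := (hexact x).mp hzero
    obtain ⟨t, rfl⟩ := ofTensorProduct_surjective_of_finite 𝔞 _ y
    clear hx hzero
    induction t with
    | zero => simp
    | tmul r b =>
      rw [ofTensorProduct_tmul, map_smul, map_of]
      exact Ideal.mul_mem_left _ r (Ideal.mem_map_of_mem _ b.2)
    | add t u ht hu => rw [map_add, map_add]; exact add_mem ht hu
  · refine Ideal.map_le_iff_le_comap.mpr fun b hb ↦ ?_
    rw [Ideal.mem_comap, RingHom.mem_ker, mapAlgebra_algebraMap, (RingHom.mem_ker).mp hb,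
      _root_.map_zero]

/-- Induction on the number of generators: modulo the first one, the completion becomes that of
B/(a) along the others. -/
theorem isNoetherianRing_of_ofList {B : Type*} [CommRing B] [IsNoetherianRing B] (l : List B) :
    IsNoetherianRing (AdicCompletion (Ideal.ofList l) B) := by
  induction hn : l.length generalizing B with
  | zero =>
    obtain rfl := List.length_eq_zero_iff.mp hn
    rw [Ideal.ofList_nil]
    exact isNoetherianRing_of_surjective B _ (algebraMap B (AdicCompletion (⊥ : Ideal B) B))
      (of_surjective ⊥ B)
  | succ n ih =>
    match l with
    | [] => simp at hn
    | a :: l =>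
    let f := algebraMap B (B ⧸ Ideal.span {a})
    have hf : Function.Surjective f := Ideal.Quotient.mk_surjective
    have hfa : f a = 0 := Ideal.Quotient.eq_zero_iff_mem.mpr (Ideal.mem_span_singleton_self a)
    have hmap : (Ideal.ofList (a :: l)).map f = Ideal.ofList (l.map f) := by
      rw [Ideal.map_ofList, List.map_cons, Ideal.ofList_cons, hfa, Ideal.span_singleton_zero,
        bot_sup_eq]
    have hN : IsNoetherianRing
        (AdicCompletion ((Ideal.ofList (a :: l)).map f) (B ⧸ Ideal.span {a})) := by
      rw [hmap]
      exact ih (l.map f) (by simpa using hn)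
    have hfg : (Ideal.ofList (a :: l)).FG := IsNoetherian.noetherian _
    have hker : RingHom.ker (mapAlgebra (Ideal.ofList (a :: l)) (B ⧸ Ideal.span {a})) =
        Ideal.span {algebraMap B _ a} := by
      rw [ker_mapAlgebra hf]
      have : RingHom.ker f = Ideal.span {a} := Ideal.mk_ker
      rw [this, Ideal.map_span, Set.image_singleton]
    have := isAdicComplete_self _ hfg
    have : IsNoetherianRing (AdicCompletion (Ideal.ofList (a :: l)) B ⧸
        Ideal.span {algebraMap B (AdicCompletion (Ideal.ofList (a :: l)) B) a}) :=
      isNoetherianRing_of_ringEquiv _ ((Ideal.quotEquivOfEq hker.symm).trans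
        (RingHom.quotientKerEquivOfSurjective (mapAlgebra_surjective hfg hf))).symm
    exact IsNoetherianRing.of_quotient_span_singleton
      ((Ideal.ofList (a :: l)).map (algebraMap B _))
      (Ideal.mem_map_of_mem _ (Ideal.subset_span List.mem_cons_self))

instance isNoetherianRing [IsNoetherianRing B] (𝔞 : Ideal B) :
    IsNoetherianRing (AdicCompletion 𝔞 B) := by
  obtain ⟨s, rfl⟩ := IsNoetherian.noetherian 𝔞
  have : Submodule.span B (s : Set B) = Ideal.ofList s.toList := by
    simp [Ideal.ofList, Ideal.span]
  rw [this]
  exact isNoetherianRing_of_ofList s.toList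

end AdicCompletion

end

/-! ### Almost Cohen–Macaulay rings and the inequality dim ≤ depth + 1 -/

section

open RingTheory.Sequence IsLocalRing

section Depth

variable {R : Type*} [CommRing R]

theorem Ideal.HasRegularSeq.le_depthOn {I : Ideal R} (hI : I ≠ ⊤) {n : ℕ}
    (h : I.HasRegularSeq R n) : n ≤ depthOn I R := by
  obtain ⟨rs, rfl, hrs, hreg⟩ := h
  refine le_iSup₂_of_le rs ⟨hrs, hreg, fun h ↦ hI ?_⟩ le_rfl
  rw [eq_top_iff, h, smul_eq_mul, Ideal.mul_top]
  exact Ideal.span_le.mpr hrs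

/-- For proper I, weak regularity on R already implies regularity, as the terms generate a proper
ideal. -/
theorem Ideal.le_depthOn_iff {I : Ideal R} (hI : I ≠ ⊤) {n : ℕ} :
    n ≤ depthOn I R ↔ I.HasRegularSeq R n := by
  refine ⟨fun h ↦ ?_, fun h ↦ h.le_depthOn hI⟩
  match n with
  | 0 => exact Ideal.hasRegularSeq_zero
  | n + 1 =>
    have hlt : (n : ℕ∞) < depthOn I R := lt_of_lt_of_le (by exact_mod_cast n.lt_succ_self) h
    simp only [depthOn, lt_iSup_iff] at hlt
    obtain ⟨rs, hrs, hlt⟩ := hlt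
    exact Ideal.HasRegularSeq.mono ⟨rs, rfl, hrs.1, hrs.2.1⟩ le_rfl (by exact_mod_cast hlt)

theorem Ideal.depthOn_le_depthOn {S : Type*} [CommRing S] {I : Ideal R} {J : Ideal S} (hI : I ≠ ⊤)
    (hJ : J ≠ ⊤) (h : ∀ n, I.HasRegularSeq R n → J.HasRegularSeq S n) :
    depthOn I R ≤ depthOn J S :=
  ENat.forall_natCast_le_iff_le.mp fun n hn ↦
    (h n ((Ideal.le_depthOn_iff hI).mp hn)).le_depthOn hJ

end Depth

section Localization

variable {R : Type*} [CommRing R] (p : Ideal R) [p.IsPrime]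

theorem Localization.AtPrime.height_maximalIdeal :
    (maximalIdeal (Localization.AtPrime p)).height = p.height := by
  have := IsLocalization.AtPrime.ringKrullDim_eq_height p (Localization.AtPrime p)
  rw [← IsLocalRing.maximalIdeal_height_eq_ringKrullDim] at this
  exact_mod_cast this

theorem Localization.AtPrime.isWeaklyRegular_map {rs : List R} (h : IsWeaklyRegular R rs) :
    IsWeaklyRegular (Localization.AtPrime p) (rs.map (algebraMap R (Localization.AtPrime p))) :=
  h.of_isLocalization _ p.primeCompl

theorem Localization.AtPrime.map_mem_maximalIdeal {rs : List R} (h : ∀ r ∈ rs, r ∈ p) :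
    ∀ r ∈ rs.map (algebraMap R (Localization.AtPrime p)),
      r ∈ maximalIdeal (Localization.AtPrime p) := by
  intro r hr
  obtain ⟨a, ha, rfl⟩ := List.mem_map.mp hr
  exact (IsLocalization.AtPrime.to_map_mem_maximal_iff _ p a).mpr (h a ha)

theorem Ideal.HasRegularSeq.localization {n : ℕ} (h : p.HasRegularSeq R n) :
    (maximalIdeal (Localization.AtPrime p)).HasRegularSeq (Localization.AtPrime p) n := by
  obtain ⟨rs, rfl, hrs, hreg⟩ := h
  exact ⟨_, by simp, Localization.AtPrime.map_mem_maximalIdeal p hrs,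
    Localization.AtPrime.isWeaklyRegular_map p hreg⟩

/-- The right-hand side says that p is associated to R/X. A socle element descends by clearing
denominators: finitely many generators of p need only one common multiplier outside p. -/
theorem Localization.AtPrime.hasSocle_quotient_iff [IsNoetherianRing R] (X : Ideal R) :
    (maximalIdeal (Localization.AtPrime p)).HasSocle
      (Localization.AtPrime p ⧸ X.map (algebraMap R (Localization.AtPrime p))) ↔
    ∃ c, ∀ r, r * c ∈ X ↔ r ∈ p := by
  let L := Localization.AtPrime p
  rw [Ideal.hasSocle_quotient_iff]
  have hmem (c : R) : algebraMap R L c ∈ X.map (algebraMap R L) ↔ ∃ s ∉ p, s * c ∈ X :=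
    IsLocalization.algebraMap_mem_map_algebraMap_iff p.primeCompl L X c
  constructor
  · rintro ⟨z, hz, hzm⟩
    obtain ⟨a, s, rfl⟩ := IsLocalization.exists_mk'_eq p.primeCompl z
    have ha : algebraMap R L a ∉ X.map (algebraMap R L) := fun h ↦ hz <| by
      rw [IsLocalization.mk'_eq_mul_mk'_one]
      exact Ideal.mul_mem_right _ _ h
    have hkill (r : R) (hr : r ∈ p) : ∃ t ∉ p, t * (r * a) ∈ X := by
      rw [← hmem]
      have h1 := hzm (algebraMap R L r)
        ((IsLocalization.AtPrime.to_map_mem_maximal_iff L p r).mpr hr)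
      have h2 := Ideal.mul_mem_right (algebraMap R L s) _ h1
      rwa [smul_eq_mul, mul_assoc, IsLocalization.mk'_spec, ← map_mul] at h2
    classical
    choose t ht using fun r : p ↦ hkill r r.2
    obtain ⟨T, hT⟩ := (Submodule.fg_top p).mpr (IsNoetherian.noetherian p)
    have hprod : ∏ r ∈ T, t r ∉ p := fun h ↦ by
      obtain ⟨r, -, hr⟩ := (Ideal.IsPrime.prod_mem_iff (p := p)).mp h
      exact (ht r).1 hr
    refine ⟨(∏ r ∈ T, t r) * a, fun r ↦ ⟨fun h ↦ ?_, fun hr ↦ ?_⟩⟩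
    · by_contra hr
      refine ha ((hmem a).mpr ⟨r * ∏ r ∈ T, t r, fun h' ↦ ?_, by rwa [mul_assoc]⟩)
      exact (‹p.IsPrime›.mem_or_mem h').elim hr hprod
    · have : ∀ r : p, (r : R) * ((∏ r ∈ T, t r) * a) ∈ X := by
        intro r
        have hr : r ∈ Submodule.span R (T : Set p) := by rw [hT]; trivial
        induction hr using Submodule.span_induction with
        | mem r hr =>
          obtain ⟨u, hu⟩ := Finset.dvd_prod_of_mem t hr
          rw [hu]
          convert X.mul_mem_left u (ht r).2 using 1
          ring
        | zero => simp
        | add r r' _ _ h h' =>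
          rw [Submodule.coe_add, add_mul]
          exact add_mem h h'
        | smul c r _ h =>
          rw [Submodule.coe_smul, smul_eq_mul, mul_assoc]
          exact X.mul_mem_left c h
      exact this ⟨r, hr⟩
  · rintro ⟨c, hc⟩
    refine ⟨algebraMap R L c, fun h ↦ ?_, fun r hr ↦ ?_⟩
    · obtain ⟨s, hs, h⟩ := (hmem c).mp h
      exact hs ((hc s).mp h)
    · obtain ⟨a, s, rfl⟩ := IsLocalization.exists_mk'_eq p.primeCompl r
      rw [IsLocalization.AtPrime.mk'_mem_maximal_iff L p] at hr
      rw [smul_eq_mul, IsLocalization.mk'_eq_mul_mk'_one, mul_right_comm, ← map_mul]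
      exact Ideal.mul_mem_right _ _ (Ideal.mem_map_of_mem _ ((hc a).mpr hr))

theorem associatedPrimes_quotient_iff [IsNoetherianRing R] (X : Ideal R) :
    IsAssociatedPrime p (R ⧸ X) ↔ ∃ c, ∀ r, r * c ∈ X ↔ r ∈ p := by
  have hmem (c r : R) : r ∈ (⊥ : Submodule R (R ⧸ X)).colon {Submodule.Quotient.mk c} ↔
      r * c ∈ X := by
    rw [Submodule.mem_colon_singleton, ← Submodule.Quotient.mk_smul, Submodule.mem_bot,
      Submodule.Quotient.mk_eq_zero, smul_eq_mul]
  rw [isAssociatedPrime_iff]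
  constructor
  · rintro ⟨-, z, hz⟩
    obtain ⟨c, rfl⟩ := Submodule.mkQ_surjective X z
    exact ⟨c, fun r ↦ by rw [← hmem]; exact (SetLike.ext_iff.mp hz r).symm⟩
  · rintro ⟨c, hc⟩
    exact ⟨‹_›, Submodule.Quotient.mk c, by ext r; rw [hmem, hc]⟩

theorem Ideal.HasRegularSeq.le_length_of_isAssociatedPrime [IsNoetherianRing R] {rs : List R}
    (hrs : ∀ r ∈ rs, r ∈ p) (hreg : IsWeaklyRegular R rs)
    (hp : IsAssociatedPrime p (R ⧸ Ideal.ofList rs)) {n : ℕ}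
    (h : (maximalIdeal (Localization.AtPrime p)).HasRegularSeq (Localization.AtPrime p) n) :
    n ≤ rs.length := by
  have hs := (Localization.AtPrime.hasSocle_quotient_iff p _).mpr
    ((associatedPrimes_quotient_iff p _).mp hp)
  rw [Ideal.map_ofList] at hs
  have := h.le_length (Localization.AtPrime.map_mem_maximalIdeal p hrs)
    (Localization.AtPrime.isWeaklyRegular_map p hreg) (by rwa [smul_eq_mul, Ideal.mul_top])
  simpa using this

theorem Ideal.HasRegularSeq.le_height_of_localization [IsNoetherianRing R] {n : ℕ}
    (h : (maximalIdeal (Localization.AtPrime p)).HasRegularSeq (Localization.AtPrime p) n) :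
    n ≤ p.height := by
  rw [← Localization.AtPrime.height_maximalIdeal]
  exact h.le_height

/-- A maximal weakly regular sequence in a prime `p`, and an associated prime of the quotient
containing `p`. -/
theorem Ideal.exists_isWeaklyRegular_isAssociatedPrime [IsNoetherianRing R] :
    ∃ rs : List R, (∀ r ∈ rs, r ∈ p) ∧ IsWeaklyRegular R rs ∧
      ∃ q, IsAssociatedPrime q (R ⧸ Ideal.ofList rs) ∧ p ≤ q := by
  obtain ⟨b, hb⟩ := ENat.ne_top_iff_exists.mp (Ideal.height_ne_top (Ideal.IsPrime.ne_top' (I := p)))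
  obtain ⟨rs, hrs, hreg, hs⟩ := Ideal.exists_maximal_isWeaklyRegular (M := R) (I := p)
    (b := b) fun n hn ↦ by
      have := (hn.localization p).le_height_of_localization
      rw [← hb] at this
      exact_mod_cast this
  rw [smul_eq_mul, Ideal.mul_top] at hs
  obtain ⟨z, hz, hzp⟩ := hs
  obtain ⟨q, hq, hle⟩ := exists_le_isAssociatedPrime_of_isNoetherianRing R z hz
  exact ⟨rs, hrs, hreg, q, hq, fun r hr ↦ hle (Submodule.mem_colon_singleton.mpr (hzp r hr))⟩

end Localization

/-- A noetherian ring all of whose local rings have `dim ≤ depth + 1` is almost Cohen–Macaulay. -/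
theorem IsAlmostCohenMacaulay.of_heightLeDepthAddOne {F : Type*} [CommRing F] [IsNoetherianRing F]
    [Nontrivial F]
    (h : ∀ (p : Ideal F) [p.IsPrime], HeightLeDepthAddOne (Localization.AtPrime p)) :
    IsAlmostCohenMacaulay F := by
  refine ⟨‹_›, ‹_›, fun p hp ↦ le_antisymm ?_ ?_⟩
  · exact Ideal.depthOn_le_depthOn hp.ne_top Ideal.IsPrime.ne_top' fun n hn ↦ hn.localization p
  · refine Ideal.depthOn_le_depthOn Ideal.IsPrime.ne_top' hp.ne_top fun n hn ↦ ?_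
    obtain ⟨rs, hrs, hreg, q, hq, hpq⟩ := Ideal.exists_isWeaklyRegular_isAssociatedPrime p
    refine Ideal.HasRegularSeq.mono ⟨rs, rfl, hrs, hreg⟩ le_rfl ?_
    rcases hpq.eq_or_lt with rfl | hlt
    · exact hn.le_length_of_isAssociatedPrime p hrs hreg hq
    -- Here n ≤ ht p ≤ ht q − 1 ≤ d, and `rs` is maximal at q, so d ≤ `rs.length`.
    · have := hq.isPrime
      obtain ⟨d, hd, hht⟩ := h q
      rw [Localization.AtPrime.height_maximalIdeal] at hht
      have h1 := hd.le_length_of_isAssociatedPrime q (fun r hr ↦ hpq (hrs r hr)) hreg hq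
      have h2 : (n : ℕ∞) ≤ p.height := hn.le_height_of_localization
      have h3 := (Ideal.height_add_one_le_of_lt_of_isPrime hlt).trans hht
      have h4 := (add_le_add_left h2 1).trans h3
      norm_cast at h4
      lia

/-- If a noetherian local ring satisfies `dim ≤ depth + 1`, so do all its localizations. -/
theorem IsLocalRing.HeightLeDepthAddOne.localization {R : Type*} [CommRing R] [IsNoetherianRing R]
    [IsLocalRing R] (h : HeightLeDepthAddOne R) (p : Ideal R) [p.IsPrime] :
    HeightLeDepthAddOne (Localization.AtPrime p) := by
  obtain ⟨n, hn, hle⟩ := h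
  obtain ⟨rs, hrs, hreg, q, hq, hpq⟩ := Ideal.exists_isWeaklyRegular_isAssociatedPrime p
  refine ⟨rs.length, Ideal.HasRegularSeq.localization p ⟨rs, rfl, hrs, hreg⟩, ?_⟩
  rw [Localization.AtPrime.height_maximalIdeal]
  -- `n` need not be the full depth of R, so the truncated difference may be 0; the bound ht q + (n
  -- − `rs.length`) ≤ n + 1 suffices in both cases.
  have h1 : (maximalIdeal R).HasRegularSeq (R ⧸ Ideal.ofList rs) (n - rs.length) := by
    rcases le_total rs.length n with hl | hl
    · obtain ⟨k, rfl⟩ := Nat.exists_eq_add_of_le hl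
      have := hn.quotient_ofList (fun r hr ↦ le_maximalIdeal Ideal.IsPrime.ne_top' (hrs r hr)) hreg
      rw [smul_eq_mul, Ideal.mul_top] at this
      rwa [Nat.add_sub_cancel_left]
    · rw [Nat.sub_eq_zero_of_le hl]
      exact Ideal.hasRegularSeq_zero
  have h2 := (IsAssociatedPrime.height_add_le hq h1).trans hle
  have h3 := (add_le_add_left (Ideal.height_mono hpq) _).trans h2
  obtain ⟨α, hα⟩ := ENat.ne_top_iff_exists.mp
    (Ideal.height_ne_top (Ideal.IsPrime.ne_top' (I := p)))
  rw [← hα] at h3 ⊢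
  norm_cast at *
  lia

/-- The maximal ideal of an almost Cohen–Macaulay local ring is, up to radical, generated by a
weakly regular sequence and one more element. -/
theorem IsAlmostCohenMacaulay.exists_isWeaklyRegular {B : Type*} [CommRing B] [IsLocalRing B]
    (hB : IsAlmostCohenMacaulay B) :
    ∃ (rs : List B) (a : B), (∀ r ∈ a :: rs, r ∈ maximalIdeal B) ∧ IsWeaklyRegular B rs ∧
      ∀ P : Ideal B, P.IsPrime → (∀ r ∈ a :: rs, r ∈ P) → P = maximalIdeal B := by
  have := hB.isNoetherianRing
  obtain ⟨rs, hrs, hreg, hsoc⟩ := IsLocalRing.exists_maximal_isWeaklyRegular B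
  -- Otherwise depth B_P > `rs.length`; the almost Cohen–Macaulay equality would put an equally long
  -- sequence inside P ⊆ m, against maximality of `rs`.
  have hass : ∀ P : Ideal B, P.IsPrime → (∀ r ∈ rs, r ∈ P) → P ≠ maximalIdeal B →
      IsAssociatedPrime P (B ⧸ Ideal.ofList rs) := by
    intro P hP hPrs hne
    rw [associatedPrimes_quotient_iff, ← Localization.AtPrime.hasSocle_quotient_iff]
    refine (Ideal.exists_isSMulRegular_or_hasSocle _ _).resolve_left ?_
    rintro ⟨x, hx, hxreg⟩
    have h1 : (maximalIdeal (Localization.AtPrime P)).HasRegularSeq (Localization.AtPrime P)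
        (rs.length + 1) := by
      have := Ideal.HasRegularSeq.append (Localization.AtPrime.map_mem_maximalIdeal P hPrs)
        (Localization.AtPrime.isWeaklyRegular_map P hreg) (n := 1) (by
          rw [smul_eq_mul, Ideal.mul_top, ← Ideal.map_ofList]
          exact Ideal.hasRegularSeq_succ.mpr ⟨x, hx, hxreg, Ideal.hasRegularSeq_zero⟩)
      simpa using this
    have h2 := h1.le_depthOn Ideal.IsPrime.ne_top'
    rw [← hB.depthOn_eq P, Ideal.le_depthOn_iff hP.ne_top] at h2
    have h3 := (h2.mono (le_maximalIdeal hP.ne_top) le_rfl).le_length hrs hreg hsoc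
    lia
  have hfin : (associatedPrimes B (B ⧸ Ideal.ofList rs) \ {maximalIdeal B}).Finite :=
    (associatedPrimes.finite B _).sdiff
  have hav : ¬ ((maximalIdeal B : Set B) ⊆
      ⋃ P ∈ associatedPrimes B (B ⧸ Ideal.ofList rs) \ {maximalIdeal B}, (P : Set B)) := by
    intro hsub
    obtain ⟨P, ⟨hP, hne⟩, hle⟩ := (Ideal.subset_union_prime_finite hfin (f := id) ⊤ ⊤
      fun P hP _ _ ↦ hP.1.isPrime).mp hsub
    exact hne (le_antisymm (le_maximalIdeal hP.isPrime.ne_top) hle)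
  obtain ⟨a, ham, ha⟩ := Set.not_subset.mp hav
  refine ⟨rs, a, by simpa using ⟨ham, hrs⟩, hreg, fun P hP hPr ↦ ?_⟩
  by_contra hne
  refine ha (Set.mem_biUnion (x := P) ⟨hass P hP (fun r hr ↦ hPr r (by simp [hr])) hne, hne⟩ ?_)
  exact hPr a (by simp)

/-- A prime of R containing the images of (a, rs) contracts to m_B, so it contains m_B R = m_R;
Krull's height theorem applies to these `rs.length` + 1 elements. -/
theorem IsAlmostCohenMacaulay.heightLeDepthAddOne_of_flat {B R : Type*} [CommRing B]
    [IsLocalRing B] [CommRing R] [IsLocalRing R] [IsNoetherianRing R] [Algebra B R]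
    [Module.Flat B R] (hB : IsAlmostCohenMacaulay B)
    (hm : maximalIdeal R = (maximalIdeal B).map (algebraMap B R)) : HeightLeDepthAddOne R := by
  classical
  obtain ⟨rs, a, hmem, hreg, hmin⟩ := hB.exists_isWeaklyRegular
  have hmem' : ∀ r ∈ a :: rs, algebraMap B R r ∈ maximalIdeal R := fun r hr ↦ by
    rw [hm]
    exact Ideal.mem_map_of_mem _ (hmem r hr)
  refine ⟨rs.length, ⟨rs.map (algebraMap B R), by simp, fun r hr ↦ ?_, hreg.of_flat⟩, ?_⟩
  · obtain ⟨b, hb, rfl⟩ := List.mem_map.mp hr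
    exact hmem' b (by simp [hb])
  · let s : Finset R := ((a :: rs).map (algebraMap B R)).toFinset
    have hs : maximalIdeal R ∈ (Ideal.span (s : Set R)).minimalPrimes := by
      refine ⟨⟨inferInstance, Ideal.span_le.mpr fun x hx ↦ ?_⟩, fun Q ⟨hQ, hsQ⟩ _ ↦ ?_⟩
      · obtain ⟨b, hb, rfl⟩ := List.mem_map.mp (List.mem_toFinset.mp hx)
        exact hmem' b hb
      · rw [hm, Ideal.map_le_iff_le_comap, hmin (Q.comap (algebraMap B R)) inferInstance
          fun r hr ↦ hsQ (Ideal.subset_span (List.mem_toFinset.mpr (List.mem_map_of_mem hr)))]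
    refine (Ideal.height_le_card_of_mem_minimalPrimes_span_finset hs).trans ?_
    have := List.toFinset_card_le ((a :: rs).map (algebraMap B R))
    simp only [List.length_map, List.length_cons] at this
    exact_mod_cast this

end

/-! ### Local rings of the formal fibers -/

section

open RingTheory.Sequence IsLocalRing

section Fibre

theorem Localization.localRingHom_surjective_of_surjective {R S : Type*} [CommRing R] [CommRing S]
    (φ : R →+* S) (hφ : Function.Surjective φ) (r : Ideal S) [r.IsPrime] :
    Function.Surjective (Localization.localRingHom (r.comap φ) r φ rfl) := by
  intro z
  obtain ⟨a, s, rfl⟩ := IsLocalization.exists_mk'_eq r.primeCompl z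
  obtain ⟨a, rfl⟩ := hφ a
  obtain ⟨s, hs⟩ := s
  obtain ⟨s, rfl⟩ := hφ s
  exact ⟨IsLocalization.mk' _ a (⟨s, hs⟩ : (r.comap φ).primeCompl), by
    rw [Localization.localRingHom_mk']⟩

theorem Localization.ker_localRingHom_le_of_surjective {R S : Type*} [CommRing R] [CommRing S]
    (φ : R →+* S) (hφ : Function.Surjective φ) (r : Ideal S) [r.IsPrime] :
    RingHom.ker (Localization.localRingHom (r.comap φ) r φ rfl) ≤
      (RingHom.ker φ).map (algebraMap R (Localization.AtPrime (r.comap φ))) := by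
  intro z hz
  obtain ⟨a, s, rfl⟩ := IsLocalization.exists_mk'_eq (r.comap φ).primeCompl z
  rw [RingHom.mem_ker, Localization.localRingHom_mk', IsLocalization.mk'_eq_zero_iff] at hz
  obtain ⟨⟨t, ht⟩, h⟩ := hz
  obtain ⟨t, rfl⟩ := hφ t
  rw [IsLocalization.mk'_eq_mul_mk'_one]
  refine Ideal.mul_mem_right _ _ ?_
  rw [IsLocalization.algebraMap_mem_map_algebraMap_iff (r.comap φ).primeCompl]
  exact ⟨t, ht, by rw [RingHom.mem_ker, map_mul]; exact h⟩

/-- Local rings of the fibres of `A → R'`, where `A = B/I`, `R' = R/IR` and `R` is flat over `B`. -/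
theorem Ideal.Fiber.heightLeDepthAddOne {B A R R' : Type*} [CommRing B] [IsNoetherianRing B]
    [CommRing A] [CommRing R] [IsNoetherianRing R] [CommRing R'] [Algebra B R] [Module.Flat B R]
    [Algebra A R'] (π : B →+* A) (hπ : Function.Surjective π) (φ : R →+* R')
    (hφ : Function.Surjective φ) (hcomp : φ.comp (algebraMap B R) = (algebraMap A R').comp π)
    (hker : RingHom.ker φ = (RingHom.ker π).map (algebraMap B R))
    (hR : ∀ (q : Ideal R) [q.IsPrime], HeightLeDepthAddOne (Localization.AtPrime q))
    (P : Ideal A) [P.IsPrime] (q' : Ideal (P.Fiber R')) [q'.IsPrime] :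
    HeightLeDepthAddOne (Localization.AtPrime q') := by
  let Q := P.comap π
  let r : Ideal R' := q'.comap (Algebra.TensorProduct.includeRight : R' →ₐ[A] P.Fiber R')
  let q := r.comap φ
  have hr : r.comap (algebraMap A R') = P := by
    have : q'.under A = P := (Ideal.over_def q' P).symm
    rw [← this]
    ext a
    simp only [r, Ideal.mem_comap, AlgHom.commutes, Ideal.under_def]
  have hq : q.comap (algebraMap B R) = Q := by
    simp only [q, Q, Ideal.comap_comap, hcomp, ← hr]
  have : q.LiesOver Q := ⟨hq.symm⟩
  let : Algebra (Localization.AtPrime Q) (Localization.AtPrime q) :=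
    Localization.AtPrime.algebraOfLiesOver Q q
  have : IsLocalHom (algebraMap (Localization.AtPrime Q) (Localization.AtPrime q)) :=
    Localization.isLocalHom_localRingHom _ _ _ _
  let lam := Localization.localRingHom q r φ rfl
  have hlam : Function.Surjective lam := Localization.localRingHom_surjective_of_surjective φ hφ r
  -- The local ring of the fiber at q' is R'_r / P R'_r, which `ψ` presents as a quotient of R_q.
  let e := Ideal.Fiber.algEquivAux₂ P q'
  let J : Ideal (Localization.AtPrime r) :=
    (P.map (algebraMap A R')).map (algebraMap R' (Localization.AtPrime r))
  let mkJ := Ideal.Quotient.mk J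
  let ψ : Localization.AtPrime q →+* Localization.AtPrime q' :=
    (e.symm.toRingEquiv : _ →+* _).comp (mkJ.comp lam)
  have hJ : J = (Q.map (algebraMap B (Localization.AtPrime q))).map lam := by
    have hP : P.map (algebraMap A R') = Q.map ((algebraMap A R').comp π) := by
      rw [← Ideal.map_map, Ideal.map_comap_of_surjective π hπ P]
    simp only [J]
    rw [hP, Ideal.map_map, Ideal.map_map,
      IsScalarTower.algebraMap_eq B R (Localization.AtPrime q)]
    congr 1
    ext b
    have hb : φ (algebraMap B R b) = algebraMap A R' (π b) := RingHom.congr_fun hcomp b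
    simp only [RingHom.comp_apply, lam, Localization.localRingHom_to_map, hb]
  refine IsLocalRing.HeightLeDepthAddOne.of_surjective_of_ker_eq (A := Localization.AtPrime Q)
    (hR q) ψ (e.symm.surjective.comp (Ideal.Quotient.mk_surjective.comp hlam)) ?_
  have h1 : (maximalIdeal (Localization.AtPrime Q)).map (algebraMap _ (Localization.AtPrime q)) =
      Q.map (algebraMap B (Localization.AtPrime q)) := by
    rw [← Localization.AtPrime.map_eq_maximalIdeal, Ideal.map_map,
      ← IsScalarTower.algebraMap_eq]
  have h2 : RingHom.ker ψ = J.comap lam := by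
    ext x
    rw [RingHom.mem_ker, Ideal.mem_comap, ← Ideal.Quotient.eq_zero_iff_mem]
    exact e.symm.map_eq_zero_iff
  -- The kernel of R_q → R'_r adds nothing to Q R_q, since it comes from ker π ⊆ Q.
  rw [h1, h2, hJ, Ideal.comap_map_of_surjective' lam hlam, sup_eq_left]
  refine (Localization.ker_localRingHom_le_of_surjective φ hφ r).trans ?_
  rw [hker, Ideal.map_map, ← IsScalarTower.algebraMap_eq]
  refine Ideal.map_mono fun b hb ↦ ?_
  rw [Ideal.mem_comap, (RingHom.mem_ker).mp hb]
  exact zero_mem P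

theorem Ideal.Fiber.isNoetherianRing {A S : Type*} [CommRing A] [CommRing S] [IsNoetherianRing S]
    [Algebra A S] (P : Ideal A) [P.IsPrime] : IsNoetherianRing (P.Fiber S) := by
  have : IsNoetherianRing (Localization (Algebra.algebraMapSubmonoid S P.primeCompl)) :=
    IsLocalization.isNoetherianRing (Algebra.algebraMapSubmonoid S P.primeCompl) _ inferInstance
  let : Algebra S (P.Fiber S) := Algebra.TensorProduct.rightAlgebra
  exact isNoetherianRing_of_ringEquiv _ (Ideal.Fiber.algEquivQuotient (S := S) P).symm.toRingEquiv

end Fibre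

end

theorem proposition2p10 {B : Type*} [CommRing B] [IsLocalRing B] (hB : IsAlmostCohenMacaulay B)
    (I : Ideal B) (hI : I ≠ ⊤) :
    haveI : IsLocalRing (B ⧸ I) := isLocalRing_quotient hI
    ∀ (P : Ideal (B ⧸ I)) [P.IsPrime], IsAlmostCohenMacaulay (FormalFiber (B ⧸ I) P) := by
  have hlocal : IsLocalRing (B ⧸ I) := isLocalRing_quotient hI
  intro P hP
  have := hB.isNoetherianRing
  have : IsNoetherianRing (FormalFiber (B ⧸ I) P) := Ideal.Fiber.isNoetherianRing P
  have : Module.FaithfullyFlat (B ⧸ I)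
      (AdicCompletion (IsLocalRing.maximalIdeal (B ⧸ I)) (B ⧸ I)) :=
    Module.FaithfullyFlat.of_flat_of_isLocalHom
  have : Nontrivial (FormalFiber (B ⧸ I) P) :=
    Module.FaithfullyFlat.rTensor_nontrivial _ _ _
  have hsurj : Function.Surjective (algebraMap B (B ⧸ I)) := Ideal.Quotient.mk_surjective
  have hmax : (IsLocalRing.maximalIdeal B).map (algebraMap B (B ⧸ I)) =
      IsLocalRing.maximalIdeal (B ⧸ I) := by
    have : (IsLocalRing.maximalIdeal (B ⧸ I)).comap (algebraMap B (B ⧸ I)) =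
        IsLocalRing.maximalIdeal B :=
      IsLocalRing.eq_maximalIdeal (Ideal.comap_isMaximal_of_surjective _ hsurj)
    rw [← this, Ideal.map_comap_of_surjective _ hsurj]
  obtain ⟨φ, hφ, hcomp, hker⟩ : ∃ φ : AdicCompletion (IsLocalRing.maximalIdeal B) B →+*
      AdicCompletion (IsLocalRing.maximalIdeal (B ⧸ I)) (B ⧸ I), Function.Surjective φ ∧
      φ.comp (algebraMap B _) = (algebraMap (B ⧸ I) _).comp (algebraMap B (B ⧸ I)) ∧
      RingHom.ker φ = (RingHom.ker (algebraMap B (B ⧸ I))).map (algebraMap B _) := by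
    -- The maximal ideal of A is the extension of that of B, so Â is the target of
    -- `AdicCompletion.mapAlgebra`.
    rw [← hmax]
    exact ⟨AdicCompletion.mapAlgebra _ _,
      AdicCompletion.mapAlgebra_surjective (IsNoetherian.noetherian _) hsurj,
      RingHom.ext (AdicCompletion.mapAlgebra_algebraMap _), AdicCompletion.ker_mapAlgebra hsurj⟩
  have hcompl : IsLocalRing.HeightLeDepthAddOne (AdicCompletion (IsLocalRing.maximalIdeal B) B) :=
    hB.heightLeDepthAddOne_of_flat AdicCompletion.maximalIdeal_eq_map
  exact IsAlmostCohenMacaulay.of_heightLeDepthAddOne fun q' _ ↦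
    Ideal.Fiber.heightLeDepthAddOne (algebraMap B (B ⧸ I)) hsurj φ hφ hcomp hker
      (fun q _ ↦ hcompl.localization q) P q'
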